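/- **Theorem.** Consider the master system $$\dot x = Ax+\varphi_0(y)+b\,\varphi(y)^T\theta,\qquad y=c^Tx,\qquad y_r=y+\xi,\qquad t\ge 0,$$ with $x(t)\in\mathbb R^n$, $\theta\in\mathbb R^m$ a constant vector, $A\in\mathbb R^{n\times n}$, $b,c\in\mathbb R^n$, and $\xi$ a bounded measurable function of time. Assume that $\varphi_0:\mathbb R\to\mathbb R^n$ and $\varphi:\mathbb R\to\mathbb R^m$ are Borel measurable and bounded on bounded sets, and that for every parameter vector and every initial state the state of the master system is a bounded function of $t\ge0$. Let $k\in\mathbb R^n$ be such that $F=A-kc^T$ is Hurwitz (all eigenvalues have negative real part), and put $H(p)=c^T(pI-F)^{-1}b$. For a scalar signal $u$, $H(p)[u]$ denotes the output $c^T\zeta$ of the filter $\dot\zeta=F\zeta+bu$ with an arbitrary initial value; on vector signals $H(p)$ acts componentwise. Differential equations are understood in the sense of Carathéodory, i.e. in integrated form, and $|\cdot|$ is the Euclidean norm. Given a trajectory $x$ of the master system on $[0,\infty)$, let $\bar\varphi(t)=\varphi(y_r(t))$, $\bar\omega=H(p)[\bar\varphi]$, and consider the adaptive observer $$\dot{\hat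 x}=A\hat x+\varphi_0(y_r)+b\,\varphi(y_r)^T\hat\theta+k(y_r-\hat y),\qquad \hat y=c^T\hat x,$$ $$\bar e=y_r-\hat y+H(p)[\bar\varphi^T\hat\theta]-\bar\omega^T\hat\theta,\qquad \dot{\hat\theta}=\gamma\,\bar\omega\,\bar e-\alpha(\hat\theta)\hat\theta,$$ $$\alpha(\hat\theta)=\begin{cases}0,&|\hat\theta|<\theta^*,\\ |\hat\theta|/\theta^*-1,&\theta^*\le|\hat\theta|\le2\theta^*,\\ 1,&|\hat\theta|>2\theta^*,\end{cases}$$ where $\gamma>0$ and $\theta^*>0$ are arbitrary. Let $\tilde\theta=\theta-\hat\theta$. Then for all initial conditions (of the observer, the estimate and the filters) the closed loop has a solution on $[0,\infty)$, and every solution on $[0,\infty)$ has the following properties. (i) All signals $x,y,y_r,\hat x,\hat y,\hat\theta,\tilde\theta,\bar\omega,\bar e$, the filter states, and the filter output $H(p)[\bar\varphi^T\hat\theta]$ are bounded on $[0,\infty)$. The system $$\dot\Xi_e=F\Xi_e+\varphi_0(y)-\varphi_0(y_r)+b\big(\varphi(y)-\varphi(y_r)\big)^T\theta-k\xi,\qquad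 \xi_e=c^T\Xi_e,$$ has a solution on $[0,\infty)$ for every initial value $\Xi_e(0)$, and for each of its solutions $\Xi_e$ and $\xi_e$ are bounded and $\tilde\theta(t)$ converges as $t\to\infty$ (its distance to the set tends to $0$) to the residual set $$D=\Big\{v\in\mathbb R^m:\ |v|^2\le\max\big[(|\theta|+2\theta^*)^2,\ \gamma\|\xi+\xi_e\|_\infty^2+|\theta|^2\big]\Big\},$$ where $\|\cdot\|_\infty$ is the $L^\infty$ norm on $[0,\infty)$. (ii) If $\xi\equiv0$ and $\theta^*>|\theta|$, then in addition $\lim_{t\to\infty}(y(t)-\hat y(t))=0$. (iii) If, additionally to the hypotheses of (ii), $\varphi$ is continuous, the function $f(t)=\varphi(y(t))$ is persistently exciting (measurable and bounded on $[0,\infty)$, with $\int_t^{t+T}f(s)f(s)^T\,ds\ge\alpha_0 I$ for all $t\ge0$ and some $\alpha_0,T>0$), and $H$ is minimum phase ($H(s)\ne0$ for all $s\in\mathbb C$ with $\operatorname{Re}s\ge0$), then $\lim_{t\to\infty}|\theta-\hat\theta(t)|=0$. -/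

import Mathlib

open MeasureTheory Filter Topology
open scoped Matrix

noncomputable section

namespace AdaptiveSync

/-- `z` is a solution on `[0, ∞)` of `ż = v` in the sense of Carathéodory: `v` is integrable on
every `[0, t]` and `z t = z 0 + ∫₀ᵗ v` (so `z` is absolutely continuous on every `[0, t]`). -/
def HasVelocity {E : Type*} [NormedAddCommGroup E] [NormedSpace ℝ E] (z v : ℝ → E) : Prop :=
  ∀ t, 0 ≤ t → IntervalIntegrable v volume 0 t ∧ z t = z 0 + ∫ s in (0 : ℝ)..t, v s

/-- Boundedness of a signal on `[0, ∞)`. -/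
def BoundedSignal {E : Type*} [Norm E] (z : ℝ → E) : Prop :=
  ∃ C : ℝ, ∀ t, 0 ≤ t → ‖z t‖ ≤ C

/-- A function of the output that is bounded for bounded values of its argument. -/
def LocallyBounded {E : Type*} [Norm E] (f : ℝ → E) : Prop :=
  ∀ R : ℝ, ∃ C : ℝ, ∀ y : ℝ, |y| ≤ R → ‖f y‖ ≤ C

/-- The known data of the master system `ẋ = A x + φ₀(y) + b φ(y)ᵀ θ`, `y = cᵀ x`. -/
structure Plant (n m : ℕ) where
  A : Matrix (Fin n) (Fin n) ℝ
  b : Fin n → ℝ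
  c : Fin n → ℝ
  φ₀ : ℝ → Fin n → ℝ
  φ : ℝ → EuclideanSpace ℝ (Fin m)

/-- A real square matrix is Hurwitz if all its complex eigenvalues have negative real part. -/
def IsHurwitz {n : ℕ} (F : Matrix (Fin n) (Fin n) ℝ) : Prop :=
  ∀ s ∈ spectrum ℂ (F.map Complex.ofReal), s.re < 0

/-- The transfer function `H(s) = cᵀ (s I - F)⁻¹ b`, for `s` outside the spectrum of `F`. -/
def transferFunction {n : ℕ} (F : Matrix (Fin n) (Fin n) ℝ) (b c : Fin n → ℝ) (s : ℂ) : ℂ :=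
  (fun i => (c i : ℂ)) ⬝ᵥ
    ((s • (1 : Matrix (Fin n) (Fin n) ℂ) - F.map Complex.ofReal)⁻¹ *ᵥ fun i => (b i : ℂ))

/-- Minimum phase for a Hurwitz `F` (so that `H` has no pole with `0 ≤ Re s`): all zeros of the
transfer function have negative real part. -/
def IsMinimumPhase {n : ℕ} (F : Matrix (Fin n) (Fin n) ℝ) (b c : Fin n → ℝ) : Prop :=
  ∀ s : ℂ, 0 ≤ s.re → transferFunction F b c s ≠ 0

/-- Persistent excitation on `[0, ∞)`: measurable, bounded, and
`∫ₜ^{t+T} f(s) f(s)ᵀ ds ≥ α I` for all `t ≥ 0`, with some `α, T > 0`. -/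
def PersistentlyExciting {m : ℕ} (f : ℝ → EuclideanSpace ℝ (Fin m)) : Prop :=
  (Measurable fun t : Set.Ici (0 : ℝ) => f t) ∧ BoundedSignal f ∧
    ∃ α T : ℝ, 0 < α ∧ 0 < T ∧ ∀ t, 0 ≤ t →
      ((Matrix.of fun i j : Fin m => ∫ s in t..(t + T), f s i * f s j)
        - α • (1 : Matrix (Fin m) (Fin m) ℝ)).PosSemidef

/-- `ζ` is the state, from an arbitrary initial value, of the filter with transfer function
`H(p) = cᵀ (p I - F)⁻¹ b` driven by `u`; the filter output `H(p)[u]` is then `cᵀ ζ`. -/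
def IsFilterState {n : ℕ} (F : Matrix (Fin n) (Fin n) ℝ) (b : Fin n → ℝ) (u : ℝ → ℝ)
    (ζ : ℝ → Fin n → ℝ) : Prop :=
  HasVelocity ζ fun t => F *ᵥ ζ t + u t • b

/-- The switching function of the dead-zone `σ`-modification with threshold `θs`. -/
def switching {m : ℕ} (θs : ℝ) (θh : EuclideanSpace ℝ (Fin m)) : ℝ :=
  if ‖θh‖ < θs then 0 else if ‖θh‖ ≤ 2 * θs then ‖θh‖ / θs - 1 else 1

/-- The `L^∞` norm on `[0, ∞)`. -/
def supNorm (f : ℝ → ℝ) : ℝ :=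
  (eLpNorm f ⊤ (volume.restrict (Set.Ici (0 : ℝ)))).toReal

/-- The residual set of the parameter error, for the total disturbance `d = ξ + ξₑ`. -/
def residualSet {m : ℕ} (γ θs : ℝ) (θ : EuclideanSpace ℝ (Fin m)) (d : ℝ → ℝ) :
    Set (EuclideanSpace ℝ (Fin m)) :=
  {v | ‖v‖ ^ 2 ≤ max ((‖θ‖ + 2 * θs) ^ 2) (γ * supNorm d ^ 2 + ‖θ‖ ^ 2)}

namespace Plant

variable {n m : ℕ}

/-- `x` is a trajectory on `[0, ∞)` of the master system with parameter vector `θ`. -/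
def IsTrajectory (P : Plant n m) (θ : EuclideanSpace ℝ (Fin m)) (x : ℝ → Fin n → ℝ) : Prop :=
  HasVelocity x fun t =>
    P.A *ᵥ x t + P.φ₀ (P.c ⬝ᵥ x t) + (inner ℝ (P.φ (P.c ⬝ᵥ x t)) θ) • P.b

/-- For every parameter vector and every initial state, the state of the master system is a
bounded function of time. -/
def BoundedTrajectories (P : Plant n m) : Prop :=
  ∀ (θ : EuclideanSpace ℝ (Fin m)) (x : ℝ → Fin n → ℝ), P.IsTrajectory θ x → BoundedSignal x

/-- `F = A - k cᵀ`. -/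
def errorMatrix (P : Plant n m) (k : Fin n → ℝ) : Matrix (Fin n) (Fin n) ℝ :=
  P.A - Matrix.vecMulVec k P.c

/-- The output signal `cᵀ z`. -/
def output (P : Plant n m) (z : ℝ → Fin n → ℝ) (t : ℝ) : ℝ :=
  P.c ⬝ᵥ z t

/-- The received signal `y_r = y + ξ`. -/
def received (P : Plant n m) (ξ : ℝ → ℝ) (x : ℝ → Fin n → ℝ) (t : ℝ) : ℝ :=
  P.output x t + ξ t

/-- The filtered regressor `ω̄ = H(p)[φ̄]`, where `Ω i` is the state of the filter driven by the
`i`-th component of `φ̄`. -/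
def filteredRegressor (P : Plant n m) (Ω : Fin m → ℝ → Fin n → ℝ) (t : ℝ) :
    EuclideanSpace ℝ (Fin m) :=
  WithLp.toLp 2 fun i => P.output (Ω i) t

/-- The augmented error `ē = y_r - ŷ + H(p)[φ̄ᵀ θ̂] - ω̄ᵀ θ̂`, where `ζ` is the state of the filter
driven by `φ̄ᵀ θ̂`. -/
def augmentedError (P : Plant n m) (ξ : ℝ → ℝ) (x xh : ℝ → Fin n → ℝ)
    (θh : ℝ → EuclideanSpace ℝ (Fin m)) (ζ : ℝ → Fin n → ℝ) (Ω : Fin m → ℝ → Fin n → ℝ)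
    (t : ℝ) : ℝ :=
  P.received ξ x t - P.output xh t + P.output ζ t - inner ℝ (P.filteredRegressor Ω t) (θh t)

/-- The closed loop driven by the master trajectory `x` and the noise `ξ`: observer state `xh`,
parameter estimate `θh`, and the states `ζ`, `Ω` of the filters in the augmentation scheme. -/
structure IsClosedLoop (P : Plant n m) (k : Fin n → ℝ) (γ θs : ℝ) (ξ : ℝ → ℝ)
    (x xh : ℝ → Fin n → ℝ) (θh : ℝ → EuclideanSpace ℝ (Fin m)) (ζ : ℝ → Fin n → ℝ)
    (Ω : Fin m → ℝ → Fin n → ℝ) : Prop where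
  observer : HasVelocity xh fun t =>
    P.A *ᵥ xh t + P.φ₀ (P.received ξ x t) + (inner ℝ (P.φ (P.received ξ x t)) (θh t)) • P.b
      + (P.received ξ x t - P.output xh t) • k
  filter : IsFilterState (P.errorMatrix k) P.b
    (fun t => inner ℝ (P.φ (P.received ξ x t)) (θh t)) ζ
  regressor : ∀ i, IsFilterState (P.errorMatrix k) P.b (fun t => P.φ (P.received ξ x t) i) (Ω i)
  adaptation : HasVelocity θh fun t =>
    (γ * P.augmentedError ξ x xh θh ζ Ω t) • P.filteredRegressor Ω t
      - switching θs (θh t) • θh t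

/-- `Ξ̇ₑ = F Ξₑ + φ₀(y) - φ₀(y_r) + b (φ(y) - φ(y_r))ᵀ θ - k ξ`. -/
def IsNoiseResponse (P : Plant n m) (k : Fin n → ℝ) (θ : EuclideanSpace ℝ (Fin m)) (ξ : ℝ → ℝ)
    (x : ℝ → Fin n → ℝ) (Ξ : ℝ → Fin n → ℝ) : Prop :=
  HasVelocity Ξ fun t =>
    P.errorMatrix k *ᵥ Ξ t + (P.φ₀ (P.output x t) - P.φ₀ (P.received ξ x t))
      + (inner ℝ (P.φ (P.output x t) - P.φ (P.received ξ x t)) θ) • P.b - ξ t • k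

end Plant

end AdaptiveSync

end

open AdaptiveSync

/-! The augmented error is a linear regression in disguise. Subtract from `x - xh + ζ` the noise
response `Ξ` and the combination `∑ θ i • Ω i`: all forcing terms cancel, and the remainder
(`residualState`) obeys the homogeneous equation with matrix `F`, so it decays exponentially. Taking
outputs, `ē = ω̄ᵀθ̃ + (ξ + ξₑ) + (decaying term)`. The filters `Ω` see only the bounded received
signal, so `ω̄` is bounded independently of the estimate, and there is no circularity in what
follows.

The Lyapunov function is `V = ‖θ - θh‖ ^ 2`. Outside the radius `‖θ‖ + 2 * θs` the leakage is
saturated, and completing a square gives `V̇ ≤ γδ²/2 + ‖θ‖² - V` for the total disturbance `δ`. This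
yields boundedness of the estimate and, with `δ` split into `ξ + ξₑ` and a vanishing part,
convergence to the residual set. Boundedness of `ζ` and then of `xh` follows.

Without noise and with `‖θ‖ < θs` the leakage is dissipative: `V̇ ≤ -γq² - 2(θs - ‖θ‖)‖leakage‖ +
γδ²`, where `q = ω̄ᵀθ̃` and `δ` decays exponentially. The dissipation is uniformly continuous with
bounded integral, so `q`, the leakage, `ē` and the velocity of the estimate all vanish. The swapping
identity then shows that `H(p)[φ̄ᵀθ̂] - ω̄ᵀθ̂` is the output of a stable filter with vanishing
input, so the output error vanishes with `ē`.

For parameter convergence, `∑ θ̃ i • Ω i` is a filter state driven by `φᵀθ̃` plus a vanishing term,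
with output `q → 0`. A minimum phase filter with vanishing output has vanishing input when that
input is uniformly continuous, so `φᵀθ̃ → 0`. As `θ̃` moves ever more slowly, persistent excitation
forces `θ̃ → 0`.

Linear systems are handled through covectors instead of matrix exponentials: those pairing `z` into
a given class of scalar signals form a subspace, and Cayley–Hamilton (`eq_top_of_forall_spectrum`)
reduces claims about `ż = F z + w` to scalar equations `u̇ = μ u + w`. Existence is Picard iteration
in an exponentially weighted norm (`exists_hasVelocity`). -/

namespace AdaptiveSync

/-! ### Calculus of Carathéodory solutions -/

namespace HasVelocity

variable {E F G : Type*} [NormedAddCommGroup E] [NormedSpace ℝ E] [NormedAddCommGroup F]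
  [NormedSpace ℝ F] [NormedAddCommGroup G] [NormedSpace ℝ G]

theorem congr {z z' v v' : ℝ → E} (h : HasVelocity z v) (hz : ∀ t, 0 ≤ t → z t = z' t)
    (hv : ∀ t, 0 ≤ t → v t = v' t) : HasVelocity z' v' := by
  intro t ht
  have hE : Set.EqOn v v' (Set.uIoc 0 t) := fun s hs => by
    rw [Set.uIoc_of_le ht] at hs
    exact hv s hs.1.le
  refine ⟨(h t ht).1.congr hE, ?_⟩
  rw [← hz t ht, ← hz 0 le_rfl, (h t ht).2]
  congr 1
  refine intervalIntegral.integral_congr_ae (Filter.Eventually.of_forall hE)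

theorem intervalIntegrable {z v : ℝ → E} (h : HasVelocity z v) {s t : ℝ} (hs : 0 ≤ s)
    (ht : 0 ≤ t) : IntervalIntegrable v volume s t :=
  (h s hs).1.symm.trans (h t ht).1

theorem sub_eq_integral {z v : ℝ → E} (h : HasVelocity z v) {s t : ℝ} (hs : 0 ≤ s)
    (ht : 0 ≤ t) : z t - z s = ∫ r in s..t, v r := by
  rw [(h t ht).2, (h s hs).2, add_sub_add_left_eq_sub,
    intervalIntegral.integral_interval_sub_left (h t ht).1 (h s hs).1]

theorem add {z v w u : ℝ → E} (h : HasVelocity z v) (h' : HasVelocity w u) :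
    HasVelocity (fun t => z t + w t) (fun t => v t + u t) := fun t ht =>
  ⟨(h t ht).1.add (h' t ht).1, by
    beta_reduce
    rw [intervalIntegral.integral_add (h t ht).1 (h' t ht).1, (h t ht).2, (h' t ht).2]; abel⟩

theorem neg {z v : ℝ → E} (h : HasVelocity z v) :
    HasVelocity (fun t => -z t) (fun t => -v t) := fun t ht =>
  ⟨(h t ht).1.neg, by
    beta_reduce
    rw [intervalIntegral.integral_neg, (h t ht).2]; abel⟩

theorem sub {z v w u : ℝ → E} (h : HasVelocity z v) (h' : HasVelocity w u) :
    HasVelocity (fun t => z t - w t) (fun t => v t - u t) := by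
  simpa only [sub_eq_add_neg] using h.add h'.neg

theorem const (a : E) : HasVelocity (fun _ => a) (fun _ => (0 : E)) := fun t _ => by simp

theorem sum {ι : Type*} {s : Finset ι} {z v : ι → ℝ → E}
    (h : ∀ i ∈ s, HasVelocity (z i) (v i)) :
    HasVelocity (fun t => ∑ i ∈ s, z i t) (fun t => ∑ i ∈ s, v i t) := by
  classical
  induction s using Finset.induction_on with
  | empty => simpa using const (0 : E)
  | insert a s ha ih =>
    simp only [Finset.sum_insert ha]
    exact (h a (by simp)).add (ih fun i hi => h i (by simp [hi]))

theorem clm [CompleteSpace E] [CompleteSpace F] {z v : ℝ → E} (h : HasVelocity z v)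
    (L : E →L[ℝ] F) :
    HasVelocity (fun t => L (z t)) (fun t => L (v t)) := fun t ht => by
  refine ⟨⟨L.integrable_comp (h t ht).1.1, L.integrable_comp (h t ht).1.2⟩, ?_⟩
  beta_reduce
  rw [L.intervalIntegral_comp_comm (h t ht).1, (h t ht).2, map_add]

theorem pi {ι : Type*} [Fintype ι] [CompleteSpace E] {z v : ι → ℝ → E}
    (h : ∀ i, HasVelocity (z i) (v i)) :
    HasVelocity (fun t i => z i t) (fun t i => v i t) := by
  classical
  have := sum (s := Finset.univ) fun i _ =>
    (h i).clm (ContinuousLinearMap.single ℝ (fun _ : ι => E) i)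
  refine this.congr (fun t _ => ?_) fun t _ => ?_ <;>
  · ext j
    simp [Finset.sum_apply, Pi.single_apply]

theorem continuousOn [CompleteSpace E] {z v : ℝ → E} (h : HasVelocity z v) :
    ContinuousOn z (Set.Ici 0) := by
  intro t ht
  have ht' : (0 : ℝ) ≤ t := ht
  have hc : ContinuousOn z (Set.Icc 0 (t + 1)) := by
    have h1 : ContinuousOn (fun s => z 0 + ∫ r in (0 : ℝ)..s, v r) (Set.Icc 0 (t + 1)) := by
      have hi : IntegrableOn v (Set.uIcc 0 (t + 1)) := by
        rw [Set.uIcc_of_le (by linarith)]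
        exact (intervalIntegrable_iff_integrableOn_Icc_of_le (by linarith)).1
          (h (t + 1) (by linarith)).1
      have := intervalIntegral.continuousOn_primitive_interval hi
      rw [Set.uIcc_of_le (by linarith)] at this
      exact continuousOn_const.add this
    exact h1.congr fun s hs => (h s hs.1).2
  have := hc t ⟨ht', by linarith⟩
  refine this.mono_of_mem_nhdsWithin ?_
  rw [← Set.Ici_inter_Iic]
  exact Filter.inter_mem self_mem_nhdsWithin
    (mem_nhdsWithin_of_mem_nhds (Iic_mem_nhds (by linarith)))

/-- Velocities are derivatives only almost everywhere, so this is integration by parts for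
absolutely continuous functions. It is applied to the primitives `z 0 + ∫ v`, because `z` itself is
uncontrolled at negative times. -/
theorem mul {z v w u : ℝ → ℝ} (h : HasVelocity z v) (h' : HasVelocity w u) :
    HasVelocity (fun t => z t * w t) (fun t => v t * w t + z t * u t) := by
  intro t ht
  have hsub : Set.uIcc 0 t ⊆ Set.Ici 0 := by
    rw [Set.uIcc_of_le ht]; exact fun s hs => hs.1
  refine ⟨((h t ht).1.mul_continuousOn (h'.continuousOn.mono hsub)).add
    ((h' t ht).1.continuousOn_mul (h.continuousOn.mono hsub)), ?_⟩
  have prim {z v : ℝ → ℝ} (h : HasVelocity z v) :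
      AbsolutelyContinuousOnInterval (fun s => (fun _ => z 0) s + ∫ r in (0 : ℝ)..s, v r) 0 t :=
    ((LipschitzWith.const (z 0)).lipschitzOnWith.absolutelyContinuousOnInterval).add
      ((h t ht).1.absolutelyContinuousOnInterval_intervalIntegral (by simp))
  have key := (prim h).integral_deriv_mul_eq_sub (prim h')
  have hI : ∫ s in (0 : ℝ)..t, (v s * w s + z s * u s) = z t * w t - z 0 * w 0 := by
    rw [(h t ht).2, (h' t ht).2]
    simp only [intervalIntegral.integral_same, add_zero] at key
    rw [← key]
    refine intervalIntegral.integral_congr_ae ?_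
    filter_upwards [(h t ht).1.ae_hasDerivAt_integral, (h' t ht).1.ae_hasDerivAt_integral]
      with s hs hs' hst
    have hst' := Set.uIoc_subset_uIcc hst
    have h0 : (0 : ℝ) ≤ s := hsub hst'
    have d := ((hs hst' 0 (by simp)).const_add (z 0)).deriv
    have d' := ((hs' hst' 0 (by simp)).const_add (w 0)).deriv
    rw [d, d', ← (h s h0).2, ← (h' s h0).2]
  rw [hI]; ring

theorem smul_const {z v : ℝ → ℝ} (h : HasVelocity z v) [CompleteSpace E] (a : E) :
    HasVelocity (fun t => z t • a) (fun t => v t • a) :=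
  h.clm ((ContinuousLinearMap.id ℝ ℝ).smulRight a)

/-- The product rule for absolutely continuous functions. -/
theorem bilin [FiniteDimensional ℝ E] [FiniteDimensional ℝ F] [CompleteSpace G]
    (B : E →L[ℝ] F →L[ℝ] G) {z v : ℝ → E} {w u : ℝ → F}
    (h : HasVelocity z v) (h' : HasVelocity w u) :
    HasVelocity (fun t => B (z t) (w t)) (fun t => B (v t) (w t) + B (z t) (u t)) := by
  have := FiniteDimensional.complete ℝ E
  have := FiniteDimensional.complete ℝ F
  let bE := Module.finBasis ℝ E
  let bF := Module.finBasis ℝ F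
  have hB (a : E) (c : F) :
      B a c = ∑ i, ∑ j, (bE.coord i a * bF.coord j c) • B (bE i) (bF j) := by
    conv_lhs => rw [← bE.sum_repr a, ← bF.sum_repr c]
    simp only [map_sum, map_smul, sum_apply, smul_apply, Module.Basis.coord_apply,
      Finset.smul_sum, smul_smul]
    rw [Finset.sum_comm]
    simp only [mul_comm]
  have key := sum (s := Finset.univ) fun i _ => sum (s := Finset.univ) fun j _ =>
    ((h.clm (LinearMap.toContinuousLinearMap (bE.coord i))).mul
      (h'.clm (LinearMap.toContinuousLinearMap (bF.coord j)))).smul_const (B (bE i) (bF j))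
  refine key.congr (fun t _ => ?_) fun t _ => ?_
  · rw [hB]; rfl
  · rw [hB (v t), hB (z t), ← Finset.sum_add_distrib]
    refine Finset.sum_congr rfl fun i _ => ?_
    rw [← Finset.sum_add_distrib]
    refine Finset.sum_congr rfl fun j _ => ?_
    rw [← add_smul]; rfl

theorem smul [FiniteDimensional ℝ E] {z v : ℝ → ℝ} {w u : ℝ → E}
    (h : HasVelocity z v) (h' : HasVelocity w u) :
    HasVelocity (fun t => z t • w t) (fun t => v t • w t + z t • u t) :=
  have := FiniteDimensional.complete ℝ E
  bilin (ContinuousLinearMap.lsmul ℝ ℝ) h h'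

theorem inner {m : ℕ} {z v w u : ℝ → EuclideanSpace ℝ (Fin m)}
    (h : HasVelocity z v) (h' : HasVelocity w u) :
    HasVelocity (fun t => inner ℝ (z t) (w t))
      (fun t => inner ℝ (v t) (w t) + inner ℝ (z t) (u t)) :=
  bilin (innerSL ℝ) h h'

theorem cmul {z v w u : ℝ → ℂ} (h : HasVelocity z v) (h' : HasVelocity w u) :
    HasVelocity (fun t => z t * w t) (fun t => v t * w t + z t * u t) :=
  bilin (ContinuousLinearMap.mul ℝ ℂ) h h'

theorem of_hasDerivAt [CompleteSpace E] {z v : ℝ → E} (h : ∀ t, HasDerivAt z (v t) t)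
    (hv : Continuous v) : HasVelocity z v := fun t _ =>
  ⟨hv.intervalIntegrable _ _, by
    rw [intervalIntegral.integral_eq_sub_of_hasDerivAt (fun s _ => h s)
      (hv.intervalIntegrable _ _)]; abel⟩

theorem norm_sub_le {z v : ℝ → E} (h : HasVelocity z v) {C : ℝ} {s t : ℝ}
    (hs : 0 ≤ s) (hst : s ≤ t) (hC : ∀ r, s ≤ r → r ≤ t → ‖v r‖ ≤ C) :
    ‖z t - z s‖ ≤ C * (t - s) := by
  rw [h.sub_eq_integral hs (hs.trans hst)]
  have := intervalIntegral.norm_integral_le_of_norm_le_const (a := s) (b := t) (f := v) (C := C)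
    fun r hr => by
      rw [Set.uIoc_of_le hst] at hr
      exact hC r hr.1.le hr.2
  rwa [abs_of_nonneg (sub_nonneg.2 hst)] at this

theorem lipschitz {z v : ℝ → E} (h : HasVelocity z v) (hv : BoundedSignal v) :
    ∃ C : NNReal, LipschitzOnWith C z (Set.Ici 0) := by
  obtain ⟨C, hC⟩ := hv
  have hC0 : 0 ≤ C := (norm_nonneg _).trans (hC 0 le_rfl)
  refine ⟨⟨C, hC0⟩, LipschitzOnWith.of_dist_le_mul fun s hs t ht => ?_⟩
  rcases le_total s t with hst | hst
  · rw [dist_comm, dist_eq_norm, dist_comm, Real.dist_eq, abs_of_nonneg (sub_nonneg.2 hst)]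
    exact h.norm_sub_le hs hst fun r hr _ => hC r (le_trans hs hr)
  · rw [dist_eq_norm, Real.dist_eq, abs_of_nonneg (sub_nonneg.2 hst)]
    exact h.norm_sub_le ht hst fun r hr _ => hC r (le_trans ht hr)

theorem uniformContinuousOn {z v : ℝ → E} (h : HasVelocity z v) (hv : BoundedSignal v) :
    UniformContinuousOn z (Set.Ici 0) :=
  (h.lipschitz hv).choose_spec.uniformContinuousOn

end HasVelocity
end AdaptiveSync

namespace AdaptiveSync

theorem uniformContinuousOn_add {α E : Type*} [UniformSpace α] [NormedAddCommGroup E]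
    {f g : α → E} {s : Set α} (hf : UniformContinuousOn f s) (hg : UniformContinuousOn g s) :
    UniformContinuousOn (fun x => f x + g x) s := by
  rw [uniformContinuousOn_iff_restrict] at *
  exact hf.add hg

/-! ### Scalar linear equations and Barbalat's lemma -/

/-- Variation of constants with the integrating factor `exp (-μ t)`. The free starting time `s`
allows a restart once the forcing has become small. -/
theorem HasVelocity.norm_le_of_linear {u w : ℝ → ℂ} {μ : ℂ} (hμ : μ.re < 0)
    (h : HasVelocity u fun t => μ * u t + w t) {s t δ : ℝ} (hs : 0 ≤ s) (hst : s ≤ t)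
    (hw : ∀ r, s ≤ r → r ≤ t → ‖w r‖ ≤ δ) :
    ‖u t‖ ≤ Real.exp (μ.re * (t - s)) * ‖u s‖ + δ / -μ.re := by
  have hδ : 0 ≤ δ := (norm_nonneg _).trans (hw s le_rfl hst)
  have hexp : HasVelocity (fun t : ℝ => Complex.exp (-μ * t))
      (fun t : ℝ => -μ * Complex.exp (-μ * t)) := by
    refine HasVelocity.of_hasDerivAt (fun t => ?_) (by fun_prop)
    have := ((Complex.ofRealCLM.hasDerivAt (x := t)).const_mul (-μ)).cexp
    simpa [mul_comm] using this
  have hprod : HasVelocity (fun t : ℝ => Complex.exp (-μ * t) * u t)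
      (fun t : ℝ => Complex.exp (-μ * t) * w t) :=
    (hexp.cmul h).congr (fun _ _ => rfl) fun t _ => by ring
  have hnorm (r : ℝ) : ‖Complex.exp (-μ * r)‖ = Real.exp (-μ.re * r) := by
    rw [Complex.norm_exp]; simp
  have hint : ∫ r in s..t, Real.exp (-μ.re * r) * δ
      = (Real.exp (-μ.re * t) - Real.exp (-μ.re * s)) * (δ / -μ.re) := by
    have hd (r : ℝ) : HasDerivAt (fun r => Real.exp (-μ.re * r) * (δ / -μ.re))
        (Real.exp (-μ.re * r) * δ) r := by
      have := (((hasDerivAt_id r).const_mul (-μ.re)).exp).mul_const (δ / -μ.re)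
      refine this.congr_deriv ?_
      have : μ.re ≠ 0 := hμ.ne
      simp only [id]
      field_simp
    rw [intervalIntegral.integral_eq_sub_of_hasDerivAt (fun r _ => hd r)
      (Continuous.intervalIntegrable (by fun_prop) _ _)]
    ring
  have hle : ‖Complex.exp (-μ * t) * u t - Complex.exp (-μ * s) * u s‖
      ≤ (Real.exp (-μ.re * t) - Real.exp (-μ.re * s)) * (δ / -μ.re) := by
    rw [hprod.sub_eq_integral hs (hs.trans hst), ← hint]
    refine intervalIntegral.norm_integral_le_of_norm_le hst ?_
      (Continuous.intervalIntegrable (by fun_prop) _ _)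
    refine Filter.Eventually.of_forall fun r hr => ?_
    rw [norm_mul, hnorm]
    exact mul_le_mul_of_nonneg_left (hw r hr.1.le hr.2) (Real.exp_pos _).le
  have h1 : Real.exp (-μ.re * t) * ‖u t‖
      ≤ Real.exp (-μ.re * s) * ‖u s‖ + Real.exp (-μ.re * t) * (δ / -μ.re) := by
    have h2 := norm_sub_norm_le (Complex.exp (-μ * t) * u t) (Complex.exp (-μ * s) * u s)
    rw [norm_mul, norm_mul, hnorm, hnorm] at h2
    have h3 : 0 ≤ Real.exp (-μ.re * s) * (δ / -μ.re) :=
      mul_nonneg (Real.exp_pos _).le (div_nonneg hδ (by linarith))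
    linarith
  have h4 : Real.exp (μ.re * t) * Real.exp (-μ.re * t) = 1 := by
    rw [← Real.exp_add]; simp
  have h5 : Real.exp (μ.re * (t - s)) = Real.exp (μ.re * t) * Real.exp (-μ.re * s) := by
    rw [← Real.exp_add]; ring_nf
  calc ‖u t‖ = Real.exp (μ.re * t) * (Real.exp (-μ.re * t) * ‖u t‖) := by
        rw [← mul_assoc, h4, one_mul]
    _ ≤ Real.exp (μ.re * t) *
        (Real.exp (-μ.re * s) * ‖u s‖ + Real.exp (-μ.re * t) * (δ / -μ.re)) :=
        mul_le_mul_of_nonneg_left h1 (Real.exp_pos _).le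
    _ = _ := by rw [h5, mul_add, ← mul_assoc, ← mul_assoc, h4, one_mul]

theorem HasVelocity.boundedSignal_of_linear {u w : ℝ → ℂ} {μ : ℂ} (hμ : μ.re < 0)
    (h : HasVelocity u fun t => μ * u t + w t) (hw : BoundedSignal w) : BoundedSignal u := by
  obtain ⟨C, hC⟩ := hw
  refine ⟨‖u 0‖ + C / -μ.re, fun t ht => ?_⟩
  refine (h.norm_le_of_linear hμ le_rfl ht fun r hr _ => hC r hr).trans ?_
  have : Real.exp (μ.re * (t - 0)) ≤ 1 := Real.exp_le_one_iff.2 (by nlinarith)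
  have := mul_le_mul_of_nonneg_right this (norm_nonneg (u 0))
  linarith

theorem HasVelocity.tendsto_zero_of_linear {u w : ℝ → ℂ} {μ : ℂ} (hμ : μ.re < 0)
    (h : HasVelocity u fun t => μ * u t + w t) (hw : Tendsto w atTop (𝓝 0)) :
    Tendsto u atTop (𝓝 0) := by
  rw [Metric.tendsto_atTop]
  intro ε hε
  have hσ : 0 < -μ.re := by linarith
  obtain ⟨N, hN⟩ := (Metric.tendsto_atTop.1 hw) (ε / 2 * -μ.re) (by positivity)
  set s := max N 0
  have hlim : Tendsto (fun t => Real.exp (μ.re * (t - s)) * ‖u s‖) atTop (𝓝 0) := by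
    rw [← zero_mul ‖u s‖]
    refine Tendsto.mul_const _ (Real.tendsto_exp_atBot.comp ?_)
    exact (tendsto_atTop_add_const_right _ _ tendsto_id).const_mul_atTop_of_neg hμ
  obtain ⟨M, hM⟩ := (Metric.tendsto_atTop.1 hlim) (ε / 2) (by positivity)
  refine ⟨max M s, fun t ht => ?_⟩
  have h1 := h.norm_le_of_linear hμ (le_max_right N 0) ((le_max_right M s).trans ht)
    (δ := ε / 2 * -μ.re) fun r hr _ => by
      simpa using (hN r ((le_max_left N 0).trans hr)).le
  have h2 := hM t ((le_max_left M s).trans ht)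
  rw [dist_zero_right, Real.norm_of_nonneg (by positivity)] at h2
  rw [mul_div_cancel_right₀ _ hσ.ne'] at h1
  rw [dist_zero_right]
  linarith

/-- Barbalat's lemma: if `u → 0` and `u̇ = p + r` with `p` uniformly continuous and `r → 0`,
then `p → 0`. -/
theorem HasVelocity.barbalat {E : Type*} [NormedAddCommGroup E] [NormedSpace ℝ E]
    [CompleteSpace E] {u p r : ℝ → E}
    (h : HasVelocity u fun t => p t + r t) (hu : Tendsto u atTop (𝓝 0))
    (hp : UniformContinuousOn p (Set.Ici 0)) (hr : Tendsto r atTop (𝓝 0)) :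
    Tendsto p atTop (𝓝 0) := by
  rw [Metric.tendsto_atTop]
  intro ε hε
  obtain ⟨δ', hδ', hp'⟩ := Metric.uniformContinuousOn_iff.1 hp (ε / 4) (by positivity)
  set δ := δ' / 2 with hδdef
  have hδ : 0 < δ := by positivity
  obtain ⟨N, hN⟩ := (Metric.tendsto_atTop.1 hu) (δ * (ε / 8)) (by positivity)
  obtain ⟨M, hM⟩ := (Metric.tendsto_atTop.1 hr) (ε / 4) (by positivity)
  refine ⟨max (max N M) 0, fun t ht => ?_⟩
  have ht0 : 0 ≤ t := (le_max_right _ _).trans ht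
  have htN : N ≤ t := (le_max_left N M).trans ((le_max_left _ _).trans ht)
  have htM : M ≤ t := (le_max_right N M).trans ((le_max_left _ _).trans ht)
  have h1 := h.sub_eq_integral ht0 (by linarith : 0 ≤ t + δ)
  have hii := h.intervalIntegrable ht0 (by linarith : 0 ≤ t + δ)
  -- On a window of length `δ` the integral of `p + r` is `δ • p t` up to `δ * ε / 2`. It also
  -- equals an increment of `u`, which is small, so `p t` must be small.
  have h2 : ‖∫ s in t..(t + δ), (p s + r s - p t)‖ ≤ (ε / 2) * |t + δ - t| := by
    refine intervalIntegral.norm_integral_le_of_norm_le_const fun s hs => ?_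
    rw [Set.uIoc_of_le (by linarith)] at hs
    have h3 : ‖p s - p t‖ < ε / 4 := by
      rw [← dist_eq_norm]
      refine hp' s (ht0.trans hs.1.le) t ht0 ?_
      rw [Real.dist_eq, abs_of_pos (by linarith [hs.1])]
      linarith [hs.2]
    have h4 : ‖r s‖ < ε / 4 := by simpa using hM s (htM.trans hs.1.le)
    calc ‖p s + r s - p t‖ = ‖(p s - p t) + r s‖ := by congr 1; abel
      _ ≤ ‖p s - p t‖ + ‖r s‖ := norm_add_le _ _
      _ ≤ ε / 2 := by linarith
  rw [intervalIntegral.integral_sub hii intervalIntegrable_const, ← h1,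
    intervalIntegral.integral_const, add_sub_cancel_left, abs_of_pos hδ] at h2
  have h5 : ‖u (t + δ)‖ < δ * (ε / 8) := by simpa using hN (t + δ) (by linarith)
  have h6 : ‖u t‖ < δ * (ε / 8) := by simpa using hN t htN
  have h7 : δ * ‖p t‖ < δ * ε := by
    calc δ * ‖p t‖ = ‖δ • p t‖ := by rw [norm_smul, Real.norm_of_nonneg hδ.le]
      _ = ‖(u (t + δ) - u t) - (u (t + δ) - u t - δ • p t)‖ := by congr 1; abel
      _ ≤ ‖u (t + δ) - u t‖ + ‖u (t + δ) - u t - δ • p t‖ := _root_.norm_sub_le _ _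
      _ ≤ (‖u (t + δ)‖ + ‖u t‖) + ε / 2 * δ := add_le_add (_root_.norm_sub_le _ _) h2
      _ < δ * ε := by nlinarith
  rw [dist_zero_right]
  exact lt_of_mul_lt_mul_left h7 hδ.le

/-- A nonnegative, uniformly continuous function with bounded integral tends to zero. -/
theorem tendsto_zero_of_integral_bounded {W : ℝ → ℝ} (hW : UniformContinuousOn W (Set.Ici 0))
    (hnn : ∀ t, 0 ≤ t → 0 ≤ W t) {C : ℝ} (hC : ∀ t, 0 ≤ t → ∫ s in (0 : ℝ)..t, W s ≤ C) :
    Tendsto W atTop (𝓝 0) := by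
  have hint (s t : ℝ) (hs : 0 ≤ s) (ht : 0 ≤ t) : IntervalIntegrable W volume s t :=
    (hW.continuousOn.mono fun r hr => (le_min hs ht).trans hr.1).intervalIntegrable
  -- Truncating at `0` makes the primitive monotone on all of `ℝ`; it therefore has a limit, and
  -- Barbalat's lemma applies to its distance from that limit.
  set U : ℝ → ℝ := fun t => ∫ s in (0 : ℝ)..max t 0, W s with hU
  have hmono : Monotone U := fun s t hst => by
    have h1 : max s 0 ≤ max t 0 := max_le_max hst le_rfl
    have h2 := intervalIntegral.integral_interval_sub_left
      (hint 0 (max t 0) le_rfl (le_max_right _ _)) (hint 0 (max s 0) le_rfl (le_max_right _ _))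
    have h3 : 0 ≤ ∫ r in (max s 0)..(max t 0), W r :=
      intervalIntegral.integral_nonneg h1 fun r hr => hnn r ((le_max_right s 0).trans hr.1)
    simp only [hU]; linarith
  have hlim := tendsto_atTop_ciSup hmono ⟨C, by
    rintro _ ⟨t, rfl⟩; exact hC _ (le_max_right _ _)⟩
  set L := ⨆ t, U t
  have hvel : HasVelocity (fun t => U t - L) (fun t => W t + 0) := fun t ht =>
    ⟨by simpa using hint 0 t le_rfl ht, by simp [hU, max_eq_left ht]; ring⟩
  refine hvel.barbalat ?_ hW tendsto_const_nhds
  simpa using hlim.sub_const L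

end AdaptiveSync

namespace AdaptiveSync

variable {n : ℕ}

/-! ### Linear systems with Hurwitz matrix -/

/-- The bilinear pairing of a complex covector with a real vector. -/
noncomputable def pairing (l : Fin n → ℂ) : (Fin n → ℝ) →L[ℝ] ℂ :=
  ∑ i, (l i) • (Complex.ofRealCLM.comp (ContinuousLinearMap.proj i))

theorem pairing_apply (l : Fin n → ℂ) (z : Fin n → ℝ) :
    pairing l z = l ⬝ᵥ fun i => (z i : ℂ) := by
  simp [pairing, sum_apply, dotProduct]

theorem pairing_add (l l' : Fin n → ℂ) (z : Fin n → ℝ) :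
    pairing (l + l') z = pairing l z + pairing l' z := by
  simp [pairing_apply, add_dotProduct]

theorem pairing_smul (a : ℂ) (l : Fin n → ℂ) (z : Fin n → ℝ) :
    pairing (a • l) z = a * pairing l z := by
  simp [pairing_apply, smul_dotProduct]

theorem pairing_sub (l l' : Fin n → ℂ) (z : Fin n → ℝ) :
    pairing (l - l') z = pairing l z - pairing l' z := by
  simp [pairing_apply, sub_dotProduct]

theorem pairing_zero (z : Fin n → ℝ) : pairing 0 z = 0 := by
  simp [pairing_apply]

theorem pairing_single (i : Fin n) (z : Fin n → ℝ) : pairing (Pi.single i 1) z = z i := by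
  simp [pairing_apply]

theorem pairing_ofReal (c z : Fin n → ℝ) :
    pairing (fun i => (c i : ℂ)) z = ((c ⬝ᵥ z : ℝ) : ℂ) := by
  simp [pairing_apply, dotProduct]

theorem pairing_mulVec (l : Fin n → ℂ) (F : Matrix (Fin n) (Fin n) ℝ) (z : Fin n → ℝ) :
    pairing l (F *ᵥ z) = pairing (l ᵥ* F.map Complex.ofReal) z := by
  rw [pairing_apply, pairing_apply, ← Matrix.dotProduct_mulVec]
  congr 1
  ext i
  simp [Matrix.mulVec, dotProduct]

/-- The covectors whose pairing with a signal belongs to a given class of scalar signals. -/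
def covectors (Q : Submodule ℂ (ℝ → ℂ)) (z : ℝ → Fin n → ℝ) : Submodule ℂ (Fin n → ℂ) where
  carrier := {l | (fun t => pairing l (z t)) ∈ Q}
  add_mem' {l l'} h h' := by
    simp only [Set.mem_ofPred_eq, pairing_add]
    exact Q.add_mem h h'
  zero_mem' := by
    simp only [Set.mem_ofPred_eq, pairing_zero]
    exact Q.zero_mem
  smul_mem' a l h := by
    simp only [Set.mem_ofPred_eq, pairing_smul]
    exact Q.smul_mem a h

theorem mem_covectors {Q : Submodule ℂ (ℝ → ℂ)} {z : ℝ → Fin n → ℝ} {l : Fin n → ℂ} :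
    l ∈ covectors Q z ↔ (fun t => pairing l (z t)) ∈ Q := Iff.rfl

/-- The characteristic polynomial splits over `ℂ`, and by Cayley–Hamilton it sends every `l` to `0 ∈
S`. Stripping off its linear factors one at a time, the hypothesis carries membership in `S` back to
`l`. No Jordan form is needed. -/
theorem eq_top_of_forall_spectrum (M : Matrix (Fin n) (Fin n) ℂ) (S : Submodule ℂ (Fin n → ℂ))
    (h : ∀ μ ∈ spectrum ℂ M, ∀ l, l ᵥ* M - μ • l ∈ S → l ∈ S) : S = ⊤ := by
  have peel : ∀ s : Multiset ℂ, (∀ μ ∈ s, μ ∈ spectrum ℂ M) → ∀ l : Fin n → ℂ,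
      l ᵥ* (Polynomial.aeval M (s.map fun a => Polynomial.X - Polynomial.C a).prod) ∈ S →
        l ∈ S := by
    intro s
    induction s using Multiset.induction_on with
    | empty => intro _ l hl; simpa using hl
    | cons a s ih =>
      intro hs l hl
      refine h a (hs a (by simp)) l (ih (fun μ hμ => hs μ (by simp [hμ])) _ ?_)
      rw [Multiset.map_cons, Multiset.prod_cons, map_mul, ← Matrix.vecMul_vecMul] at hl
      have h1 : l ᵥ* M - a • l
          = l ᵥ* Polynomial.aeval M (Polynomial.X - Polynomial.C a) := by
        simp [Matrix.vecMul_sub, Algebra.algebraMap_eq_smul_one, Matrix.vecMul_smul]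
      rwa [h1]
  rw [eq_top_iff]
  intro l _
  refine peel M.charpoly.roots (fun μ hμ => ?_) l ?_
  · rw [Matrix.mem_spectrum_iff_isRoot_charpoly]
    exact Polynomial.isRoot_of_mem_roots hμ
  · have h1 : (M.charpoly.roots.map fun a => Polynomial.X - Polynomial.C a).prod = M.charpoly :=
      ((IsAlgClosed.splits M.charpoly).eq_prod_roots_of_monic M.charpoly_monic).symm
    rw [h1, Matrix.aeval_self_charpoly]
    simp

theorem HasVelocity.pairing {F : Matrix (Fin n) (Fin n) ℝ} {z w : ℝ → Fin n → ℝ}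
    (h : HasVelocity z fun t => F *ᵥ z t + w t) (l : Fin n → ℂ) :
    HasVelocity (fun t => pairing l (z t)) fun t =>
      AdaptiveSync.pairing (l ᵥ* F.map Complex.ofReal) (z t) + AdaptiveSync.pairing l (w t) :=
  (h.clm (AdaptiveSync.pairing l)).congr (fun _ _ => rfl) fun t _ => by
    rw [map_add, pairing_mulVec]

/-- If `l (F - μ)` pairs `z` into `Q`, then `u = l z` solves `u̇ = μ u + (element of Q)`. Closure of
`Q` under the scalar filters at the eigenvalues is thus enough; it is used for bounded, vanishing
and exponentially decaying signals. -/
theorem covectors_eq_top (Q : Submodule ℂ (ℝ → ℂ)) {F : Matrix (Fin n) (Fin n) ℝ}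
    (hQ : ∀ μ ∈ spectrum ℂ (F.map Complex.ofReal), ∀ u w : ℝ → ℂ,
      (HasVelocity u fun t => μ * u t + w t) → w ∈ Q → u ∈ Q)
    {z w : ℝ → Fin n → ℝ} (h : HasVelocity z fun t => F *ᵥ z t + w t)
    (hw : covectors Q w = ⊤) : covectors Q z = ⊤ := by
  refine eq_top_of_forall_spectrum (F.map Complex.ofReal) _ fun μ hμ l hl => ?_
  refine hQ μ hμ _ (fun t => pairing (l ᵥ* F.map Complex.ofReal - μ • l) (z t) + pairing l (w t))
    ((h.pairing l).congr (fun _ _ => rfl) fun t _ => ?_) ?_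
  · rw [pairing_sub, pairing_smul]; ring
  · exact Q.add_mem hl (by rw [← mem_covectors, hw]; trivial)

/-- The scalar signals which are bounded on `[0, ∞)`. -/
def boundedSignals : Submodule ℂ (ℝ → ℂ) where
  carrier := {u | BoundedSignal u}
  add_mem' := by
    rintro u v ⟨C, hC⟩ ⟨D, hD⟩
    exact ⟨C + D, fun t ht => (norm_add_le _ _).trans (add_le_add (hC t ht) (hD t ht))⟩
  zero_mem' := ⟨0, fun t _ => by simp⟩
  smul_mem' := by
    rintro a u ⟨C, hC⟩
    exact ⟨‖a‖ * C, fun t ht => by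
      rw [Pi.smul_apply, norm_smul]
      exact mul_le_mul_of_nonneg_left (hC t ht) (norm_nonneg _)⟩

/-- The scalar signals which tend to zero. -/
def vanishingSignals : Submodule ℂ (ℝ → ℂ) where
  carrier := {u | Tendsto u atTop (𝓝 0)}
  add_mem' {u v} hu hv := by
    have := Tendsto.add hu hv
    rwa [add_zero] at this
  zero_mem' := tendsto_const_nhds
  smul_mem' a u hu := by
    have := Tendsto.const_smul hu a
    rwa [smul_zero] at this

/-- The scalar signals which decay at least like `exp (-a t)`. -/
def decayingSignals (a : ℝ) : Submodule ℂ (ℝ → ℂ) where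
  carrier := {u | BoundedSignal fun t : ℝ => Complex.exp (a * t) * u t}
  add_mem' {u v} hu hv := by
    simp only [Set.mem_ofPred_eq, Pi.add_apply, mul_add]
    exact boundedSignals.add_mem hu hv
  zero_mem' := ⟨0, fun t _ => by simp⟩
  smul_mem' c u hu := by
    simp only [Set.mem_ofPred_eq, Pi.smul_apply, smul_eq_mul, mul_left_comm _ c]
    exact boundedSignals.smul_mem c hu

theorem covectors_bounded_eq_top_iff {z : ℝ → Fin n → ℝ} :
    covectors boundedSignals z = ⊤ ↔ BoundedSignal z := by
  constructor
  · intro h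
    have h1 (i : Fin n) : BoundedSignal fun t => z t i := by
      have : Pi.single i 1 ∈ covectors boundedSignals z := h ▸ trivial
      obtain ⟨C, hC⟩ := this
      exact ⟨C, fun t ht => by simpa [pairing_single] using hC t ht⟩
    choose C hC using h1
    refine ⟨∑ i, |C i|, fun t ht => ?_⟩
    refine (pi_norm_le_iff_of_nonneg (Finset.sum_nonneg fun _ _ => abs_nonneg _)).2 fun i => ?_
    exact (hC i t ht).trans ((le_abs_self _).trans
      (Finset.single_le_sum (f := fun i => |C i|) (fun _ _ => abs_nonneg _) (Finset.mem_univ i)))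
  · rintro ⟨C, hC⟩
    refine eq_top_iff.2 fun l _ => ⟨‖pairing l‖ * C, fun t ht => ?_⟩
    exact (pairing l).le_opNorm_of_le (hC t ht)

theorem covectors_vanishing_eq_top_iff {z : ℝ → Fin n → ℝ} :
    covectors vanishingSignals z = ⊤ ↔ Tendsto z atTop (𝓝 0) := by
  constructor
  · intro h
    refine tendsto_pi_nhds.2 fun i => ?_
    have : Pi.single i 1 ∈ covectors vanishingSignals z := h ▸ trivial
    have h1 : Tendsto (fun t => pairing (Pi.single i 1) (z t)) atTop (𝓝 0) := this
    simp only [pairing_single] at h1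
    exact (Complex.continuous_re.tendsto 0).comp h1
  · intro h
    refine eq_top_iff.2 fun l _ => ?_
    have := ((pairing l).continuous.tendsto 0).comp h
    rw [map_zero] at this
    exact this

theorem IsHurwitz.boundedSignal {F : Matrix (Fin n) (Fin n) ℝ} (hF : IsHurwitz F)
    {z w : ℝ → Fin n → ℝ} (h : HasVelocity z fun t => F *ᵥ z t + w t) (hw : BoundedSignal w) :
    BoundedSignal z :=
  covectors_bounded_eq_top_iff.1 <| covectors_eq_top _
    (fun μ hμ _ _ hu hw => hu.boundedSignal_of_linear (hF μ hμ) hw) h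
    (covectors_bounded_eq_top_iff.2 hw)

theorem IsHurwitz.tendsto_zero {F : Matrix (Fin n) (Fin n) ℝ} (hF : IsHurwitz F)
    {z w : ℝ → Fin n → ℝ} (h : HasVelocity z fun t => F *ᵥ z t + w t)
    (hw : Tendsto w atTop (𝓝 0)) : Tendsto z atTop (𝓝 0) :=
  covectors_vanishing_eq_top_iff.1 <| covectors_eq_top _
    (fun μ hμ _ _ hu hw => hu.tendsto_zero_of_linear (hF μ hμ) hw) h
    (covectors_vanishing_eq_top_iff.2 hw)

/-- Multiplying by `exp (a t)` shifts `μ` to `μ + a`, still in the open left half-plane, and turns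
decay into boundedness. -/
theorem HasVelocity.mem_decayingSignals {u w : ℝ → ℂ} {μ : ℂ} {a : ℝ} (hμ : μ.re < -a)
    (h : HasVelocity u fun t => μ * u t + w t) (hw : w ∈ decayingSignals a) :
    u ∈ decayingSignals a := by
  have hexp : HasVelocity (fun t : ℝ => Complex.exp (a * t))
      (fun t : ℝ => a * Complex.exp (a * t)) := by
    refine HasVelocity.of_hasDerivAt (fun t => ?_) (by fun_prop)
    have := ((Complex.ofRealCLM.hasDerivAt (x := t)).const_mul (a : ℂ)).cexp
    simpa [mul_comm] using this
  refine HasVelocity.boundedSignal_of_linear (μ := μ + a)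
    (w := fun t : ℝ => Complex.exp (a * t) * w t) (by simp; linarith)
    ((hexp.cmul h).congr (fun _ _ => rfl) fun t _ => ?_) hw
  ring

theorem IsHurwitz.exists_exp_decay {F : Matrix (Fin n) (Fin n) ℝ} (hF : IsHurwitz F)
    {z : ℝ → Fin n → ℝ} (h : HasVelocity z fun t => F *ᵥ z t) (c : Fin n → ℝ) :
    ∃ a C : ℝ, 0 < a ∧ ∀ t, 0 ≤ t → |c ⬝ᵥ z t| ≤ C * Real.exp (-a * t) := by
  have hfin : (spectrum ℂ (F.map Complex.ofReal)).Finite := Matrix.finite_spectrum _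
  -- The spectrum is finite, so one margin `a` serves all eigenvalues.
  obtain ⟨a, ha, hspec⟩ : ∃ a : ℝ, 0 < a ∧ ∀ μ ∈ spectrum ℂ (F.map Complex.ofReal), μ.re < -a := by
    have h1 : ∀ᶠ a in 𝓝[>] (0 : ℝ), ∀ μ ∈ spectrum ℂ (F.map Complex.ofReal), μ.re < -a := by
      rw [hfin.eventually_all]
      intro μ hμ
      have : ∀ᶠ a in 𝓝 (0 : ℝ), a < -μ.re := Iio_mem_nhds (by linarith [hF μ hμ])
      filter_upwards [nhdsWithin_le_nhds this] with a ha
      linarith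
    obtain ⟨a, h2, h3⟩ := (h1.and self_mem_nhdsWithin).exists
    exact ⟨a, h3, h2⟩
  have h0 : HasVelocity z fun t => F *ᵥ z t + (fun _ => 0) t :=
    h.congr (fun _ _ => rfl) fun t _ => (add_zero _).symm
  have htop := covectors_eq_top (decayingSignals a)
    (fun μ hμ _ _ hu hw => hu.mem_decayingSignals (hspec μ hμ) hw) h0
    (eq_top_iff.2 fun l _ => by
      simp only [mem_covectors, map_zero]
      exact (decayingSignals a).zero_mem)
  have hc : (fun i => (c i : ℂ)) ∈ covectors (decayingSignals a) z := htop ▸ trivial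
  obtain ⟨C, hC⟩ := hc
  refine ⟨a, C, ha, fun t ht => ?_⟩
  have := hC t ht
  beta_reduce at this
  rw [pairing_ofReal, norm_mul, Complex.norm_exp, Complex.norm_real] at this
  simp only [Complex.mul_re, Complex.ofReal_re, Complex.ofReal_im, mul_zero, sub_zero,
    Real.norm_eq_abs] at this
  rw [neg_mul, Real.exp_neg, ← div_eq_mul_inv, le_div_iff₀ (Real.exp_pos _)]
  linarith

end AdaptiveSync

namespace AdaptiveSync

/-! ### Global existence for Lipschitz Carathéodory equations -/

section Existence

variable {E : Type*} [NormedAddCommGroup E] [NormedSpace ℝ E]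

theorem norm_exp_smul_integral_le {g : ℝ → E} {A a t : ℝ} (ha : 0 < a)
    (hA : 0 ≤ A) (ht : 0 ≤ t) (hg : ∀ s, 0 ≤ s → ‖g s‖ ≤ A * Real.exp (a * s)) :
    ‖Real.exp (-(a * t)) • ∫ s in (0 : ℝ)..t, g s‖ ≤ A / a := by
  have hint : ∫ s in (0 : ℝ)..t, A * Real.exp (a * s) = A / a * (Real.exp (a * t) - 1) := by
    have hd (r : ℝ) : HasDerivAt (fun r => A / a * Real.exp (a * r)) (A * Real.exp (a * r)) r := by
      have := (((hasDerivAt_id r).const_mul a).exp).const_mul (A / a)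
      refine this.congr_deriv ?_
      simp only [id]
      field_simp
    rw [intervalIntegral.integral_eq_sub_of_hasDerivAt (fun r _ => hd r)
      (Continuous.intervalIntegrable (by fun_prop) _ _)]
    simp; ring
  have h1 : ‖∫ s in (0 : ℝ)..t, g s‖ ≤ A / a * (Real.exp (a * t) - 1) := by
    rw [← hint]
    exact intervalIntegral.norm_integral_le_of_norm_le ht
      (Filter.Eventually.of_forall fun s hs => hg s hs.1.le)
      (Continuous.intervalIntegrable (by fun_prop) _ _)
  rw [norm_smul, Real.norm_of_nonneg (Real.exp_pos _).le, Real.exp_neg,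
    inv_mul_le_iff₀ (Real.exp_pos _)]
  have : 0 ≤ A / a := by positivity
  nlinarith

variable [CompleteSpace E]

/-- Picard iteration for `w = exp (-a t) z` in the space of bounded continuous functions. The weight
makes the iteration contract on the whole half-line, so no local solutions have to be glued. -/
theorem exists_hasVelocity (G : ℝ → E → E)
    (hmeas : ∀ z : ℝ → E, Continuous z →
      AEStronglyMeasurable (fun t => G t (z t)) (volume.restrict (Set.Ici 0)))
    {K C : ℝ} (hK : ∀ t, 0 ≤ t → ∀ p q, ‖G t p - G t q‖ ≤ K * ‖p - q‖)
    (hC : ∀ t, 0 ≤ t → ‖G t 0‖ ≤ C) (z₀ : E) :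
    ∃ z : ℝ → E, HasVelocity z (fun t => G t (z t)) ∧ z 0 = z₀ := by
  set K' := |K| + 1 with hK'
  have hK'pos : 0 < K' := by positivity
  -- Integrating against the weight gains a factor `1 / a`, so the contraction constant is `K' / a =
  -- 1 / 2`.
  set a := 2 * K' with ha
  have hapos : 0 < a := by positivity
  have hC0 : 0 ≤ C := (norm_nonneg _).trans (hC 0 le_rfl)
  have hLip (t : ℝ) (ht : 0 ≤ t) (p q : E) : ‖G t p - G t q‖ ≤ K' * ‖p - q‖ :=
    (hK t ht p q).trans (mul_le_mul_of_nonneg_right (by linarith [le_abs_self K]) (norm_nonneg _))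
  let g (w : BoundedContinuousFunction ℝ E) (t : ℝ) : E := G t (Real.exp (a * t) • w t)
  have hgb (w : BoundedContinuousFunction ℝ E) (t : ℝ) (ht : 0 ≤ t) :
      ‖g w t‖ ≤ (C + K' * ‖w‖) * Real.exp (a * t) := by
    have h1 := hLip t ht (Real.exp (a * t) • w t) 0
    rw [sub_zero, norm_smul, Real.norm_of_nonneg (Real.exp_pos _).le] at h1
    have h2 : ‖g w t‖ ≤ ‖G t (Real.exp (a * t) • w t) - G t 0‖ + ‖G t 0‖ := by
      simpa using norm_add_le (G t (Real.exp (a * t) • w t) - G t 0) (G t 0)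
    have h3 : 1 ≤ Real.exp (a * t) := Real.one_le_exp (by positivity)
    have h4 : K' * (Real.exp (a * t) * ‖w t‖) ≤ K' * (Real.exp (a * t) * ‖w‖) := by
      gcongr; exact w.norm_coe_le_norm t
    have h5 := mul_le_mul_of_nonneg_left h3 hC0
    linarith [hC t ht]
  have hgi (w : BoundedContinuousFunction ℝ E) (t : ℝ) (ht : 0 ≤ t) :
      IntervalIntegrable (g w) volume 0 t := by
    have hc : IntervalIntegrable (fun s => (C + K' * ‖w‖) * Real.exp (a * s)) volume 0 t :=
      Continuous.intervalIntegrable (by fun_prop) _ _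
    refine hc.mono_fun ?_ ?_
    · refine (hmeas (fun t => Real.exp (a * t) • w t) (by fun_prop)).mono_measure
        (Measure.restrict_mono (fun s hs => ?_) le_rfl)
      rw [Set.uIoc_of_le ht] at hs
      exact hs.1.le
    · refine (ae_restrict_iff' measurableSet_uIoc).2 (Filter.Eventually.of_forall fun s hs => ?_)
      rw [Set.uIoc_of_le ht] at hs
      exact (hgb w s hs.1.le).trans (le_abs_self _)
  have hvel (w : BoundedContinuousFunction ℝ E) :
      HasVelocity (fun t => z₀ + ∫ s in (0 : ℝ)..t, g w s) (g w) := fun t ht =>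
    ⟨hgi w t ht, by simp⟩
  -- The argument `max t 0` extends the iterate continuously to negative times, where the equation
  -- says nothing.
  have hcont (w : BoundedContinuousFunction ℝ E) : Continuous fun t : ℝ =>
      Real.exp (-(a * max t 0)) • (z₀ + ∫ s in (0 : ℝ)..max t 0, g w s) := by
    refine Continuous.smul (by fun_prop) ?_
    exact (hvel w).continuousOn.comp_continuous (by fun_prop : Continuous fun t : ℝ => max t 0)
      fun t => Set.mem_Ici.2 (le_max_right _ _)
  let T (w : BoundedContinuousFunction ℝ E) : BoundedContinuousFunction ℝ E :=
    BoundedContinuousFunction.ofNormedAddCommGroup _ (hcont w) (‖z₀‖ + (C + K' * ‖w‖) / a)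
      fun t => by
      rw [smul_add]
      refine (norm_add_le _ _).trans (add_le_add ?_ ?_)
      · rw [norm_smul, Real.norm_of_nonneg (Real.exp_pos _).le]
        have : Real.exp (-(a * max t 0)) ≤ 1 := by
          rw [Real.exp_le_one_iff]
          have := le_max_right t 0
          have := mul_nonneg hapos.le this
          linarith
        exact mul_le_of_le_one_left (norm_nonneg _) this
      · exact norm_exp_smul_integral_le hapos (by positivity) (le_max_right _ _) (hgb w)
  have hT : ContractingWith (1 / 2) T := by
    refine ⟨by rw [← NNReal.coe_lt_coe]; norm_num, LipschitzWith.of_dist_le_mul fun w w' => ?_⟩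
    rw [BoundedContinuousFunction.dist_le (by positivity)]
    intro t
    have h1 : T w t - T w' t
        = Real.exp (-(a * max t 0)) • ∫ s in (0 : ℝ)..max t 0, (g w s - g w' s) := by
      rw [intervalIntegral.integral_sub (hgi w _ (le_max_right _ _)) (hgi w' _ (le_max_right _ _))]
      change Real.exp (-(a * max t 0)) • (z₀ + ∫ s in (0 : ℝ)..max t 0, g w s)
        - Real.exp (-(a * max t 0)) • (z₀ + ∫ s in (0 : ℝ)..max t 0, g w' s) = _
      rw [← smul_sub, add_sub_add_left_eq_sub]
    rw [dist_eq_norm, h1]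
    have h2 := norm_exp_smul_integral_le (g := fun s => g w s - g w' s) (A := K' * dist w w') hapos
      (by positivity) (le_max_right t 0) fun s hs => by
        have h3 := hLip s hs (Real.exp (a * s) • w s) (Real.exp (a * s) • w' s)
        rw [← smul_sub, norm_smul, Real.norm_of_nonneg (Real.exp_pos _).le,
          ← dist_eq_norm (w s)] at h3
        refine h3.trans ?_
        have : dist (w s) (w' s) ≤ dist w w' := BoundedContinuousFunction.dist_coe_le_dist s
        calc K' * (Real.exp (a * s) * dist (w s) (w' s))
            ≤ K' * (Real.exp (a * s) * dist w w') := by gcongr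
          _ = _ := by ring
    refine h2.trans (le_of_eq ?_)
    rw [ha]; push_cast; field_simp
  obtain ⟨w, hw⟩ : ∃ w, T w = w := ⟨_, hT.fixedPoint_isFixedPt⟩
  have hz (t : ℝ) (ht : 0 ≤ t) :
      z₀ + ∫ s in (0 : ℝ)..t, g w s = Real.exp (a * t) • w t := by
    have h1 : T w t = Real.exp (-(a * max t 0)) • (z₀ + ∫ s in (0 : ℝ)..max t 0, g w s) := rfl
    rw [hw, max_eq_left ht] at h1
    rw [h1, smul_smul, ← Real.exp_add]
    simp
  refine ⟨fun t => Real.exp (a * t) • w t, (hvel w).congr hz fun t _ => rfl, ?_⟩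
  have := hz 0 le_rfl
  simpa using this.symm

end Existence

/-! ### Differential inequalities -/

/-- After the last time at which `V ≤ M`, the velocity is nonpositive almost everywhere, so `V`
cannot end above `M`. The almost everywhere form is needed because an `L^∞` norm bounds a
disturbance only off a null set. -/
theorem HasVelocity.le_of_velocity_nonpos {V v : ℝ → ℝ} (h : HasVelocity V v) {t₀ M : ℝ}
    (ht₀ : 0 ≤ t₀) (hv : ∀ᵐ t, t₀ ≤ t → M < V t → v t ≤ 0) (h0 : V t₀ ≤ M) :
    ∀ t, t₀ ≤ t → V t ≤ M := by
  intro t ht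
  by_contra! hlt
  have hc : ContinuousOn V (Set.Icc t₀ t) := h.continuousOn.mono fun s hs => ht₀.trans hs.1
  have hcpt : IsCompact (Set.Icc t₀ t ∩ V ⁻¹' Set.Iic M) :=
    isCompact_Icc.of_isClosed_subset (hc.preimage_isClosed_of_isClosed isClosed_Icc isClosed_Iic)
      Set.inter_subset_left
  obtain ⟨s, ⟨hs, hsM⟩, hmax⟩ := hcpt.exists_isGreatest ⟨t₀, ⟨le_rfl, ht⟩, h0⟩
  have h1 := h.sub_eq_integral (ht₀.trans hs.1) (ht₀.trans ht)
  have h2 : ∫ r in s..t, v r ≤ ∫ r in s..t, (0 : ℝ) := by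
    refine intervalIntegral.integral_mono_ae_restrict hs.2
      (h.intervalIntegrable (ht₀.trans hs.1) (ht₀.trans ht)) (by simp) ?_
    refine (ae_restrict_iff' measurableSet_Icc).2 ?_
    have hne : ∀ᵐ r : ℝ, r ≠ s := by simp [ae_iff, measure_singleton]
    filter_upwards [hv, hne] with r hr hrs hrI
    refine hr (hs.1.trans hrI.1) ?_
    by_contra! hle
    exact hrs (le_antisymm (hmax ⟨⟨hs.1.trans hrI.1, hrI.2⟩, hle⟩) hrI.1)
  simp only [intervalIntegral.integral_zero] at h2
  have : V s ≤ M := hsM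
  linarith

theorem HasVelocity.eventually_le_of_velocity_le {V v : ℝ → ℝ} (h : HasVelocity V v)
    {t₀ M η : ℝ} (ht₀ : 0 ≤ t₀) (hη : 0 < η) (hV : ∀ t, 0 ≤ V t)
    (hv : ∀ᵐ t, t₀ ≤ t → M < V t → v t ≤ -η) : ∀ᶠ t in atTop, V t ≤ M := by
  obtain ⟨s, hs, hsM⟩ : ∃ s, t₀ ≤ s ∧ V s ≤ M := by
    by_contra! hcon
    -- By this time a decrease at rate `η` would bring `V` down to `-1`, contradicting `V ≥ 0`. So
    -- the level is reached, and the previous lemma keeps `V` below it.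
    set t := t₀ + (V t₀ + 1) / η with ht
    have hle : t₀ ≤ t := by
      have : 0 ≤ (V t₀ + 1) / η := div_nonneg (by linarith [hV t₀]) hη.le
      linarith
    have h1 := h.sub_eq_integral ht₀ (ht₀.trans hle)
    have h2 : ∫ r in t₀..t, v r ≤ ∫ r in t₀..t, -η := by
      refine intervalIntegral.integral_mono_ae_restrict hle
        (h.intervalIntegrable ht₀ (ht₀.trans hle)) (by simp) ?_
      refine (ae_restrict_iff' measurableSet_Icc).2 ?_
      filter_upwards [hv] with r hr hrI using hr hrI.1 (hcon r hrI.1)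
    rw [intervalIntegral.integral_const, smul_eq_mul, ← h1] at h2
    have h3 : (t - t₀) * -η = -(V t₀ + 1) := by rw [ht]; field_simp; ring
    linarith [hV t]
  filter_upwards [eventually_ge_atTop s] with t ht
  refine h.le_of_velocity_nonpos (ht₀.trans hs) ?_ hsM t ht
  filter_upwards [hv] with r hr hrs hrM
  linarith [hr (hs.trans hrs) hrM]

end AdaptiveSync

namespace AdaptiveSync

variable {n : ℕ}

/-! ### Inversion of a minimum phase system -/

theorem IsHurwitz.isUnit_det {F : Matrix (Fin n) (Fin n) ℝ} (hF : IsHurwitz F) {s : ℂ}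
    (hs : 0 ≤ s.re) :
    IsUnit (s • (1 : Matrix (Fin n) (Fin n) ℂ) - F.map Complex.ofReal).det := by
  rw [← Matrix.isUnit_iff_isUnit_det, ← Algebra.algebraMap_eq_smul_one]
  by_contra h
  exact absurd (hF s h) (not_lt.2 hs)

/-- If all of `S` annihilated `b`, then `S` would be invariant under the invertible matrix `-F`. In
finite dimension `c = l (-F)` for some `l ∈ S`, whence `H(0) = l b = 0`. Only the value of `H` at
`0` is used. -/
theorem exists_dotProduct_ne_zero_of_minimumPhase {F : Matrix (Fin n) (Fin n) ℝ}
    (hF : IsHurwitz F) {b c : Fin n → ℝ} (hmp : IsMinimumPhase F b c)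
    (S : Submodule ℂ (Fin n → ℂ)) (hc : (fun i => (c i : ℂ)) ∈ S)
    (hS : ∀ l ∈ S, (l ⬝ᵥ fun i => (b i : ℂ)) = 0 → l ᵥ* F.map Complex.ofReal ∈ S) :
    ∃ l ∈ S, (l ⬝ᵥ fun i => (b i : ℂ)) ≠ 0 := by
  by_contra! hcon
  set N := (0 : ℂ) • (1 : Matrix (Fin n) (Fin n) ℂ) - F.map Complex.ofReal with hN
  have hdet : IsUnit N.det := hF.isUnit_det (by simp)
  have hNS : ∀ l ∈ S, N.vecMulLinear l ∈ S := fun l hl => by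
    rw [Matrix.vecMulLinear_apply, hN, zero_smul, zero_sub, Matrix.vecMul_neg]
    exact S.neg_mem (hS l hl (hcon l hl))
  have hinj : Function.Injective (N.vecMulLinear.restrict hNS) := fun l l' hll => by
    have h1 : (l : Fin n → ℂ) ᵥ* N = l' ᵥ* N := congrArg Subtype.val hll
    have h2 := congrArg (· ᵥ* N⁻¹) h1
    simp only [Matrix.vecMul_vecMul, Matrix.mul_nonsing_inv N hdet, Matrix.vecMul_one] at h2
    exact Subtype.ext h2
  obtain ⟨l, hl⟩ := LinearMap.injective_iff_surjective.1 hinj ⟨_, hc⟩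
  have h1 : (l : Fin n → ℂ) ᵥ* N = fun i => (c i : ℂ) := congrArg Subtype.val hl
  refine hmp 0 (by simp) ?_
  rw [transferFunction, ← hN, ← h1, Matrix.dotProduct_mulVec, Matrix.vecMul_vecMul,
    Matrix.mul_nonsing_inv N hdet, Matrix.vecMul_one]
  exact hcon l l.2

/-- Modes of the zero dynamics with nonnegative real part do not occur for a minimum phase
system. -/
theorem mem_of_vecMul_sub_smul_mem {F : Matrix (Fin n) (Fin n) ℝ}
    (hF : IsHurwitz F) {b c : Fin n → ℝ} (hmp : IsMinimumPhase F b c)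
    (S : Submodule ℂ (Fin n → ℂ)) (hc : (fun i => (c i : ℂ)) ∈ S) (k : Fin n → ℂ)
    {M : Matrix (Fin n) (Fin n) ℂ}
    (hM : M = F.map Complex.ofReal - Matrix.vecMulVec (fun i => (b i : ℂ)) k)
    (hS : ∀ l ∈ S, l ᵥ* M ∈ S) {μ : ℂ} (hμ : 0 ≤ μ.re) {l : Fin n → ℂ}
    (hl : l ᵥ* M - μ • l ∈ S) : l ∈ S := by
  set f : (Fin n → ℂ) →ₗ[ℂ] (Fin n → ℂ) := M.vecMulLinear - μ • LinearMap.id with hf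
  have hfa (l : Fin n → ℂ) : f l = l ᵥ* M - μ • l := by simp [hf]
  have hfS : S ≤ S.comap f := fun l hl => by
    rw [Submodule.mem_comap, hfa]
    exact S.sub_mem (hS l hl) (S.smul_mem _ hl)
  -- Otherwise a nonzero vector `w` annihilates both `S` and the range of `f`: `M w = μ w` and `c w
  -- = 0`. Then `(μ - F) w = -(k w) b`, so `0 = c w = -(k w) H(μ)`. As `H(μ) ≠ 0`, first `k w = 0`
  -- and then `w = 0`.
  have htop : LinearMap.range f ⊔ S = ⊤ := by
    by_contra hne
    obtain ⟨ψ, hψ, hle⟩ := Submodule.exists_le_ker_of_lt_top _ (lt_top_iff_ne_top.2 hne)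
    set w : Fin n → ℂ := fun i => ψ (Pi.single i 1) with hw
    have hψw (l : Fin n → ℂ) : ψ l = l ⬝ᵥ w := by
      conv_lhs => rw [LinearMap.pi_apply_eq_sum_univ ψ l]
      simp only [dotProduct, hw, smul_eq_mul]
      refine Finset.sum_congr rfl fun i _ => ?_
      congr 2
      ext j
      simp [Pi.single_apply, eq_comm]
    have hMw : M *ᵥ w = μ • w := by
      refine dotProduct_eq _ _ fun l => ?_
      have h1 : ψ (f l) = 0 := hle (Submodule.mem_sup_left ⟨l, rfl⟩)
      rw [hψw, hfa, sub_dotProduct, smul_dotProduct, ← Matrix.dotProduct_mulVec, sub_eq_zero] at h1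
      rw [dotProduct_comm, h1, smul_dotProduct, dotProduct_comm]
    set N := μ • (1 : Matrix (Fin n) (Fin n) ℂ) - F.map Complex.ofReal with hN
    have hdet : IsUnit N.det := hF.isUnit_det hμ
    have hNw : N *ᵥ w = -(k ⬝ᵥ w) • fun i => (b i : ℂ) := by
      rw [hM, Matrix.sub_mulVec, Matrix.vecMulVec_mulVec] at hMw
      rw [hN, Matrix.sub_mulVec, Matrix.smul_mulVec, Matrix.one_mulVec, ← hMw]
      ext i
      simp [mul_comm]
    have hw' : w = -(k ⬝ᵥ w) • (N⁻¹ *ᵥ fun i => (b i : ℂ)) := by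
      rw [← Matrix.mulVec_smul, ← hNw, Matrix.mulVec_mulVec, Matrix.nonsing_inv_mul N hdet,
        Matrix.one_mulVec]
    have hcw : (fun i => (c i : ℂ)) ⬝ᵥ w = 0 := by
      rw [← hψw]
      exact hle (Submodule.mem_sup_right hc)
    have hk : k ⬝ᵥ w = 0 := by
      rw [hw', dotProduct_smul, smul_eq_mul] at hcw
      have := (mul_eq_zero.1 hcw).resolve_right (hmp μ hμ)
      simpa using this
    rw [hk, neg_zero, zero_smul] at hw'
    refine hψ (LinearMap.ext fun l => ?_)
    rw [hψw, hw']
    simp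
  -- On the finite-dimensional quotient by `S` the map induced by `f` is surjective, hence
  -- injective, which is the claim.
  have hsurj : Function.Surjective (S.mapQ S f hfS) := by
    intro q
    obtain ⟨v, rfl⟩ := S.mkQ_surjective q
    have : v ∈ LinearMap.range f ⊔ S := htop ▸ trivial
    obtain ⟨_, ⟨u, rfl⟩, s, hs, rfl⟩ := Submodule.mem_sup.1 this
    refine ⟨S.mkQ u, ?_⟩
    rw [map_add, (by simpa using hs : S.mkQ s = 0), add_zero]
    simp
  have hinj := LinearMap.injective_iff_surjective.2 hsurj
  have h0 : S.mapQ S f hfS (S.mkQ l) = S.mapQ S f hfS 0 := by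
    rw [map_zero]
    rw [Submodule.mkQ_apply, Submodule.mapQ_apply, hfa]
    exact (Submodule.Quotient.mk_eq_zero S).2 hl
  simpa using hinj h0

/-- If the output of a minimum phase system tends to zero, then so does its uniformly continuous
input. -/
theorem IsMinimumPhase.input_tendsto_zero {F : Matrix (Fin n) (Fin n) ℝ}
    (hF : IsHurwitz F) {b c : Fin n → ℝ} (hmp : IsMinimumPhase F b c)
    {z r : ℝ → Fin n → ℝ} {g : ℝ → ℝ}
    (h : HasVelocity z fun t => F *ᵥ z t + (g t • b + r t))
    (hz : UniformContinuousOn z (Set.Ici 0)) (hg : UniformContinuousOn g (Set.Ici 0))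
    (hr : Tendsto r atTop (𝓝 0)) (hout : Tendsto (fun t => c ⬝ᵥ z t) atTop (𝓝 0)) :
    Tendsto g atTop (𝓝 0) := by
  set S := covectors vanishingSignals z with hS
  set M := F.map Complex.ofReal with hM
  set b' : Fin n → ℂ := fun i => (b i : ℂ) with hb'
  have hpr (l : Fin n → ℂ) : Tendsto (fun t => pairing l (r t)) atTop (𝓝 0) := by
    have := ((pairing l).continuous.tendsto 0).comp hr
    rwa [map_zero] at this
  have hpb (l : Fin n → ℂ) (t : ℝ) :
      pairing l (g t • b + r t) = (g t : ℂ) * (l ⬝ᵥ b') + pairing l (r t) := by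
    rw [map_add, map_smul, pairing_apply l b, Complex.real_smul]
  have hmem (l : Fin n → ℂ) : l ∈ S ↔ Tendsto (fun t => pairing l (z t)) atTop (𝓝 0) := Iff.rfl
  have hgc : UniformContinuousOn (fun t => (g t : ℂ)) (Set.Ici 0) :=
    Complex.ofRealCLM.uniformContinuous.comp_uniformContinuousOn hg
  -- Barbalat's lemma for `l z`: a vanishing output has a vanishing derivative. Starting from `c`,
  -- this enlarges the set of known vanishing outputs until the input appears in a derivative.
  have key (l : Fin n → ℂ) (hl : l ∈ S) :
      Tendsto (fun t => pairing (l ᵥ* M) (z t) + (g t : ℂ) * (l ⬝ᵥ b')) atTop (𝓝 0) := by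
    refine HasVelocity.barbalat ((h.pairing l).congr (fun _ _ => rfl) fun t _ => ?_) hl ?_ (hpr l)
    · rw [hpb]; ring
    · exact uniformContinuousOn_add
        ((pairing (l ᵥ* M)).uniformContinuous.comp_uniformContinuousOn hz)
        (((ContinuousLinearMap.mul ℝ ℂ).flip
          (l ⬝ᵥ b')).uniformContinuous.comp_uniformContinuousOn hgc)
  have hc : (fun i => (c i : ℂ)) ∈ S := by
    rw [hmem]
    simp only [pairing_ofReal]
    exact (Complex.continuous_ofReal.tendsto' 0 0 (by simp)).comp hout
  obtain ⟨l₁, hl₁, hl₁b⟩ := exists_dotProduct_ne_zero_of_minimumPhase hF hmp S hc fun l hl hlb => by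
    have := key l hl
    rw [show l ⬝ᵥ b' = 0 from hlb] at this
    simp only [mul_zero, add_zero] at this
    exact this
  obtain ⟨l₀, hl₀, hl₀b⟩ : ∃ l ∈ S, l ⬝ᵥ b' = 1 :=
    ⟨(l₁ ⬝ᵥ b')⁻¹ • l₁, S.smul_mem _ hl₁, by
      rw [smul_dotProduct, smul_eq_mul, inv_mul_cancel₀ hl₁b]⟩
  have hg0 : Tendsto (fun t => pairing (l₀ ᵥ* M) (z t) + (g t : ℂ)) atTop (𝓝 0) := by
    simpa [hl₀b] using key l₀ hl₀
  -- Up to a vanishing term the input equals the feedback `-(l₀ M) z`. Substituting it gives the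
  -- matrix `M₀`, under which `S` is invariant; on the quotient by `S` it describes the zero
  -- dynamics.
  set M₀ := M - Matrix.vecMulVec b' (l₀ ᵥ* M) with hM₀
  have hvM (l : Fin n → ℂ) : l ᵥ* M₀ = l ᵥ* M - (l ⬝ᵥ b') • (l₀ ᵥ* M) := by
    rw [hM₀, Matrix.vecMul_sub, Matrix.vecMul_vecMulVec]
  have hinv (l : Fin n → ℂ) (hl : l ∈ S) : l ᵥ* M₀ ∈ S := by
    rw [hmem]
    have := (key l hl).sub (hg0.const_mul (l ⬝ᵥ b'))
    rw [mul_zero, sub_zero] at this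
    refine this.congr fun t => ?_
    rw [hvM, pairing_sub, pairing_smul]; ring
  -- Eigenvalues in the open left half-plane give stable scalar filters; at the others, minimum
  -- phase gives membership in `S` directly. So the whole state vanishes, and with it the feedback
  -- expression for the input.
  have htop : S = ⊤ := by
    refine eq_top_of_forall_spectrum M₀ S fun μ _ l hl => ?_
    rcases lt_or_ge μ.re 0 with hμ | hμ
    · have hv : HasVelocity (fun t => pairing l (z t)) fun t => μ * pairing l (z t) +
          (pairing (l ᵥ* M₀ - μ • l) (z t) + (l ⬝ᵥ b') * (pairing (l₀ ᵥ* M) (z t) + (g t : ℂ))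
            + pairing l (r t)) :=
        (h.pairing l).congr (fun _ _ => rfl) fun t _ => by
          rw [hpb, pairing_sub, hvM, pairing_sub, pairing_smul, pairing_smul]; ring
      refine hv.tendsto_zero_of_linear hμ ?_
      have := (((hmem _).1 hl).add (hg0.const_mul (l ⬝ᵥ b'))).add (hpr l)
      simpa using this
    · exact mem_of_vecMul_sub_smul_mem hF hmp S hc _ hM₀ hinv hμ hl
  have h1 : l₀ ᵥ* M ∈ S := htop ▸ trivial
  have h2 : Tendsto (fun t => (g t : ℂ)) atTop (𝓝 0) := by
    simpa using hg0.sub ((hmem _).1 h1)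
  exact (Complex.continuous_re.tendsto 0).comp h2

end AdaptiveSync

namespace AdaptiveSync

variable {n m : ℕ}

/-! ### Bounded signals -/

namespace BoundedSignal

variable {E F : Type*} [NormedAddCommGroup E] [NormedAddCommGroup F]

theorem add {z w : ℝ → E} (hz : BoundedSignal z) (hw : BoundedSignal w) :
    BoundedSignal fun t => z t + w t := by
  obtain ⟨C, hC⟩ := hz
  obtain ⟨D, hD⟩ := hw
  exact ⟨C + D, fun t ht => (norm_add_le _ _).trans (add_le_add (hC t ht) (hD t ht))⟩

theorem neg {z : ℝ → E} (hz : BoundedSignal z) : BoundedSignal fun t => -z t := by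
  obtain ⟨C, hC⟩ := hz
  exact ⟨C, fun t ht => by rw [norm_neg]; exact hC t ht⟩

theorem sub {z w : ℝ → E} (hz : BoundedSignal z) (hw : BoundedSignal w) :
    BoundedSignal fun t => z t - w t := by
  simpa only [sub_eq_add_neg] using hz.add hw.neg

theorem const (a : E) : BoundedSignal fun _ : ℝ => a := ⟨‖a‖, fun _ _ => le_rfl⟩

theorem clm [NormedSpace ℝ E] [NormedSpace ℝ F] {z : ℝ → E} (hz : BoundedSignal z) (L : E →L[ℝ] F) :
    BoundedSignal fun t => L (z t) := by
  obtain ⟨C, hC⟩ := hz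
  exact ⟨‖L‖ * C, fun t ht => L.le_opNorm_of_le (hC t ht)⟩

theorem smul [NormedSpace ℝ E] {a : ℝ → ℝ} {z : ℝ → E} (ha : BoundedSignal a)
    (hz : BoundedSignal z) :
    BoundedSignal fun t => a t • z t := by
  obtain ⟨C, hC⟩ := ha
  obtain ⟨D, hD⟩ := hz
  refine ⟨C * D, fun t ht => ?_⟩
  rw [norm_smul]
  exact mul_le_mul (hC t ht) (hD t ht) (norm_nonneg _) ((norm_nonneg _).trans (hC t ht))

theorem inner {z w : ℝ → EuclideanSpace ℝ (Fin m)} (hz : BoundedSignal z) (hw : BoundedSignal w) :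
    BoundedSignal fun t => inner ℝ (z t) (w t) := by
  obtain ⟨C, hC⟩ := hz
  obtain ⟨D, hD⟩ := hw
  exact ⟨C * D, fun t ht => (norm_inner_le_norm _ _).trans
    (mul_le_mul (hC t ht) (hD t ht) (norm_nonneg _) ((norm_nonneg _).trans (hC t ht)))⟩

theorem comp {f : ℝ → E} (hf : LocallyBounded f) {y : ℝ → ℝ} (hy : BoundedSignal y) :
    BoundedSignal fun t => f (y t) := by
  obtain ⟨R, hR⟩ := hy
  obtain ⟨C, hC⟩ := hf R
  exact ⟨C, fun t ht => hC _ (hR t ht)⟩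

end BoundedSignal

theorem uniformContinuousOn_inner {f g : ℝ → EuclideanSpace ℝ (Fin m)}
    (hf : UniformContinuousOn f (Set.Ici 0)) (hg : UniformContinuousOn g (Set.Ici 0))
    (hfb : BoundedSignal f) (hgb : BoundedSignal g) :
    UniformContinuousOn (fun t => (inner ℝ (f t) (g t) : ℝ)) (Set.Ici 0) := by
  obtain ⟨C, hC⟩ := hfb
  obtain ⟨D, hD⟩ := hgb
  have hC0 : 0 ≤ C := (norm_nonneg _).trans (hC 0 le_rfl)
  have hD0 : 0 ≤ D := (norm_nonneg _).trans (hD 0 le_rfl)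
  rw [Metric.uniformContinuousOn_iff] at *
  intro ε hε
  obtain ⟨δ₁, hδ₁, h₁⟩ := hf (ε / (2 * (D + 1))) (by positivity)
  obtain ⟨δ₂, hδ₂, h₂⟩ := hg (ε / (2 * (C + 1))) (by positivity)
  refine ⟨min δ₁ δ₂, lt_min hδ₁ hδ₂, fun s hs t ht hst => ?_⟩
  have e1 := h₁ s hs t ht (hst.trans_le (min_le_left _ _))
  have e2 := h₂ s hs t ht (hst.trans_le (min_le_right _ _))
  rw [dist_eq_norm] at e1 e2
  rw [Real.dist_eq]
  have e3 : inner ℝ (f s) (g s) - inner ℝ (f t) (g t)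
      = inner ℝ (f s - f t) (g s) + inner ℝ (f t) (g s - g t) := by
    rw [inner_sub_left, inner_sub_right]; ring
  have e4 : |inner ℝ (f s - f t) (g s)| ≤ ε / (2 * (D + 1)) * D :=
    (abs_real_inner_le_norm _ _).trans (mul_le_mul e1.le (hD s hs) (norm_nonneg _) (by positivity))
  have e5 : |inner ℝ (f t) (g s - g t)| ≤ C * (ε / (2 * (C + 1))) :=
    (abs_real_inner_le_norm _ _).trans (mul_le_mul (hC t ht) e2.le (norm_nonneg _) hC0)
  have e6 : ε / (2 * (D + 1)) * D < ε / 2 := by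
    rw [div_mul_eq_mul_div, div_lt_div_iff₀ (by positivity) (by positivity)]; nlinarith
  have e7 : C * (ε / (2 * (C + 1))) < ε / 2 := by
    rw [mul_div_assoc', div_lt_div_iff₀ (by positivity) (by positivity)]; nlinarith
  rw [e3]
  linarith [abs_add_le (inner ℝ (f s - f t) (g s)) (inner ℝ (f t) (g s - g t))]

/-- The linear functional `z ↦ cᵀ z`. -/
noncomputable def dotCLM (c : Fin n → ℝ) : (Fin n → ℝ) →L[ℝ] ℝ :=
  LinearMap.toContinuousLinearMap
    { toFun := fun z => c ⬝ᵥ z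
      map_add' := fun z w => dotProduct_add c z w
      map_smul' := fun a z => dotProduct_smul a c z }

theorem dotCLM_apply (c z : Fin n → ℝ) : dotCLM c z = c ⬝ᵥ z := rfl

/-- The linear map `z ↦ A z`. -/
noncomputable def mulVecCLM (A : Matrix (Fin n) (Fin n) ℝ) : (Fin n → ℝ) →L[ℝ] (Fin n → ℝ) :=
  LinearMap.toContinuousLinearMap A.mulVecLin

/-! ### The switching function -/

theorem switching_eq {θs : ℝ} (hθs : 0 < θs) (v : EuclideanSpace ℝ (Fin m)) :
    switching θs v = max 0 (min 1 (‖v‖ / θs - 1)) := by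
  unfold switching
  split_ifs with h1 h2
  · have : ‖v‖ / θs < 1 := (div_lt_one hθs).2 h1
    rw [max_eq_left]
    exact (min_le_right _ _).trans (by linarith)
  · have h3 : 1 ≤ ‖v‖ / θs := (one_le_div hθs).2 (not_lt.1 h1)
    have h4 : ‖v‖ / θs ≤ 2 := (div_le_iff₀ hθs).2 h2
    rw [min_eq_right (by linarith), max_eq_right (by linarith)]
  · have h4 : 2 < ‖v‖ / θs := (lt_div_iff₀ hθs).2 (not_le.1 h2)
    rw [min_eq_left (by linarith), max_eq_right (by linarith)]

theorem switching_nonneg {θs : ℝ} (hθs : 0 < θs) (v : EuclideanSpace ℝ (Fin m)) :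
    0 ≤ switching θs v := by
  rw [switching_eq hθs]; exact le_max_left _ _

theorem switching_le_one {θs : ℝ} (hθs : 0 < θs) (v : EuclideanSpace ℝ (Fin m)) :
    switching θs v ≤ 1 := by
  rw [switching_eq hθs]; exact max_le zero_le_one (min_le_left _ _)

/-- With `w` the shorter vector, either both gains are saturated, or `‖w‖ ≤ 2 * θs` compensates the
Lipschitz constant `1 / θs` of the gain. This contributes `2`, and the remaining term, with gain at
most one, contributes `1`. -/
theorem norm_switching_smul_sub_le {θs : ℝ} (hθs : 0 < θs) (v w : EuclideanSpace ℝ (Fin m)) :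
    ‖switching θs v • v - switching θs w • w‖ ≤ 3 * ‖v - w‖ := by
  wlog hle : ‖w‖ ≤ ‖v‖ generalizing v w
  · rw [norm_sub_rev, norm_sub_rev v]
    exact this w v (not_le.1 hle).le
  have h1 : switching θs v • v - switching θs w • w
      = switching θs v • (v - w) + (switching θs v - switching θs w) • w := by module
  have h2 : ‖switching θs v • (v - w)‖ ≤ ‖v - w‖ := by
    rw [norm_smul, Real.norm_of_nonneg (switching_nonneg hθs v)]
    exact mul_le_of_le_one_left (norm_nonneg _) (switching_le_one hθs v)
  have h3 : ‖(switching θs v - switching θs w) • w‖ ≤ 2 * ‖v - w‖ := by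
    rw [norm_smul]
    rcases lt_or_ge (2 * θs) ‖w‖ with hw | hw
    · have hs {u : EuclideanSpace ℝ (Fin m)} (hu : 2 * θs < ‖u‖) : switching θs u = 1 := by
        unfold switching
        rw [if_neg (by linarith), if_neg (by linarith)]
      rw [hs hw, hs (hw.trans_le hle)]
      simp
    · have h4 : |switching θs v - switching θs w| ≤ ‖v - w‖ / θs := by
        rw [switching_eq hθs, switching_eq hθs]
        calc |max 0 (min 1 (‖v‖ / θs - 1)) - max 0 (min 1 (‖w‖ / θs - 1))|
            ≤ |min 1 (‖v‖ / θs - 1) - min 1 (‖w‖ / θs - 1)| := by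
              have := abs_max_sub_max_le_max 0 (min 1 (‖v‖ / θs - 1)) 0 (min 1 (‖w‖ / θs - 1))
              simpa using this
          _ ≤ |(‖v‖ / θs - 1) - (‖w‖ / θs - 1)| := by
              have := abs_min_sub_min_le_max 1 (‖v‖ / θs - 1) 1 (‖w‖ / θs - 1)
              simpa using this
          _ = |‖v‖ - ‖w‖| / θs := by
              rw [← abs_of_pos hθs, ← abs_div, abs_of_pos hθs]; congr 1; ring
          _ ≤ ‖v - w‖ / θs := by
              gcongr; exact abs_norm_sub_norm_le v w
      rw [Real.norm_eq_abs]
      calc |switching θs v - switching θs w| * ‖w‖ ≤ ‖v - w‖ / θs * (2 * θs) := by gcongr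
        _ = 2 * ‖v - w‖ := by field_simp
  rw [h1]
  linarith [norm_add_le (switching θs v • (v - w)) ((switching θs v - switching θs w) • w)]

theorem lipschitzWith_switching_smul {θs : ℝ} (hθs : 0 < θs) :
    LipschitzWith 3 fun v : EuclideanSpace ℝ (Fin m) => switching θs v • v :=
  LipschitzWith.of_dist_le_mul fun v w => by
    rw [dist_eq_norm, dist_eq_norm]
    exact norm_switching_smul_sub_le hθs v w

/-! ### The error equations -/

namespace Plant

theorem errorMatrix_mulVec (P : Plant n m) (k z : Fin n → ℝ) :
    P.errorMatrix k *ᵥ z = P.A *ᵥ z - (P.c ⬝ᵥ z) • k := by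
  rw [errorMatrix, Matrix.sub_mulVec, Matrix.vecMulVec_mulVec]
  ext i
  simp

theorem boundedSignal_output (P : Plant n m) {z : ℝ → Fin n → ℝ} (hz : BoundedSignal z) :
    BoundedSignal (P.output z) :=
  hz.clm (dotCLM P.c)

theorem output_combination (P : Plant n m) (Ω : Fin m → ℝ → Fin n → ℝ)
    (v : EuclideanSpace ℝ (Fin m)) (t : ℝ) :
    P.c ⬝ᵥ (∑ i, v i • Ω i t) = inner ℝ (P.filteredRegressor Ω t) v := by
  rw [dotProduct_sum, PiLp.inner_apply]
  refine Finset.sum_congr rfl fun i _ => ?_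
  simp [filteredRegressor, output, dotProduct_smul]

theorem boundedSignal_filteredRegressor (P : Plant n m) {Ω : Fin m → ℝ → Fin n → ℝ}
    (hΩ : ∀ i, BoundedSignal (Ω i)) : BoundedSignal (P.filteredRegressor Ω) := by
  choose C hC using fun i => P.boundedSignal_output (hΩ i)
  have h1 : BoundedSignal fun t (i : Fin m) => P.output (Ω i) t :=
    ⟨∑ i, |C i|, fun t ht =>
      (pi_norm_le_iff_of_nonneg (Finset.sum_nonneg fun _ _ => abs_nonneg _)).2 fun i =>
        (hC i t ht).trans ((le_abs_self _).trans (Finset.single_le_sum (f := fun i => |C i|)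
          (fun _ _ => abs_nonneg _) (Finset.mem_univ i)))⟩
  exact h1.clm (EuclideanSpace.equiv (Fin m) ℝ).symm.toContinuousLinearMap

end Plant

theorem exists_norm_combination_le {Ω : Fin m → ℝ → Fin n → ℝ} (hΩ : ∀ i, BoundedSignal (Ω i)) :
    ∃ C : ℝ, 0 ≤ C ∧ ∀ t, 0 ≤ t → ∀ v : EuclideanSpace ℝ (Fin m),
      ‖∑ i, v i • Ω i t‖ ≤ C * ‖v‖ := by
  choose C hC using hΩ
  have h0 (i : Fin m) : 0 ≤ C i := (norm_nonneg _).trans (hC i 0 le_rfl)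
  refine ⟨∑ i, C i, Finset.sum_nonneg fun i _ => h0 i, fun t ht v => ?_⟩
  rw [Finset.sum_mul]
  refine norm_sum_le_of_le _ fun i _ => ?_
  rw [norm_smul, mul_comm]
  exact mul_le_mul (hC i t ht) (PiLp.norm_apply_le v i) (norm_nonneg _) (h0 i)

/-- The swapping identity: the velocity of a linear combination of filter states with time-varying
coefficients. -/
theorem hasVelocity_combination {F : Matrix (Fin n) (Fin n) ℝ} {b : Fin n → ℝ}
    {f ϑ ν : ℝ → EuclideanSpace ℝ (Fin m)} {Ω : Fin m → ℝ → Fin n → ℝ}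
    (hΩ : ∀ i, IsFilterState F b (fun t => f t i) (Ω i)) (hϑ : HasVelocity ϑ ν) :
    HasVelocity (fun t => ∑ i, ϑ t i • Ω i t) fun t =>
      F *ᵥ (∑ i, ϑ t i • Ω i t) + (inner ℝ (f t) (ϑ t) • b + ∑ i, ν t i • Ω i t) := by
  have h := HasVelocity.sum (s := Finset.univ) fun i _ =>
    (hϑ.clm (EuclideanSpace.proj i : EuclideanSpace ℝ (Fin m) →L[ℝ] ℝ)).smul (hΩ i)
  refine h.congr (fun _ _ => rfl) fun t _ => ?_
  rw [PiLp.inner_apply, Finset.sum_smul, Matrix.mulVec_sum, ← Finset.sum_add_distrib,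
    ← Finset.sum_add_distrib]
  refine Finset.sum_congr rfl fun i _ => ?_
  rw [Matrix.mulVec_smul]
  simp only [PiLp.proj_apply, RCLike.inner_apply, conj_trivial]
  module

end AdaptiveSync

namespace AdaptiveSync

variable {n m : ℕ}

/-! ### Existence of solutions -/

theorem exists_linear_response (F : Matrix (Fin n) (Fin n) ℝ) {w : ℝ → Fin n → ℝ}
    (hw : AEStronglyMeasurable w (volume.restrict (Set.Ici 0))) (hwb : BoundedSignal w)
    (z₀ : Fin n → ℝ) :
    ∃ z : ℝ → Fin n → ℝ, HasVelocity z (fun t => F *ᵥ z t + w t) ∧ z 0 = z₀ := by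
  obtain ⟨C, hC⟩ := hwb
  refine exists_hasVelocity (fun t z => F *ᵥ z + w t) (fun z hz => ?_)
    (K := ‖mulVecCLM F‖) (C := C) (fun t _ p q => ?_) (fun t ht => ?_) z₀
  · exact (((mulVecCLM F).continuous.comp hz).aestronglyMeasurable).add hw
  · rw [add_sub_add_right_eq_sub, ← Matrix.mulVec_sub]
    exact (mulVecCLM F).le_opNorm _
  · simpa using hC t ht

namespace Plant

section Signals

variable {P : Plant n m} {θ : EuclideanSpace ℝ (Fin m)} {ξ : ℝ → ℝ} {x : ℝ → Fin n → ℝ}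

theorem aemeasurable_received
    (hξ_meas : AEMeasurable ξ (volume.restrict (Set.Ici (0 : ℝ)))) (hx : P.IsTrajectory θ x) :
    AEMeasurable (P.received ξ x) (volume.restrict (Set.Ici (0 : ℝ))) :=
  (((dotCLM P.c).continuous.comp_continuousOn hx.continuousOn).aemeasurable
    measurableSet_Ici).add hξ_meas

theorem aemeasurable_output (hx : P.IsTrajectory θ x) :
    AEMeasurable (P.output x) (volume.restrict (Set.Ici (0 : ℝ))) :=
  ((dotCLM P.c).continuous.comp_continuousOn hx.continuousOn).aemeasurable measurableSet_Ici

theorem boundedSignal_received (hx : BoundedSignal x) (hξ : BoundedSignal ξ) :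
    BoundedSignal (P.received ξ x) :=
  (P.boundedSignal_output hx).add hξ

/-- The forcing term of the noise response. -/
noncomputable def noiseForcing (P : Plant n m) (k : Fin n → ℝ) (θ : EuclideanSpace ℝ (Fin m))
    (ξ : ℝ → ℝ) (x : ℝ → Fin n → ℝ) (t : ℝ) : Fin n → ℝ :=
  (P.φ₀ (P.output x t) - P.φ₀ (P.received ξ x t))
    + (inner ℝ (P.φ (P.output x t) - P.φ (P.received ξ x t)) θ) • P.b - ξ t • k

theorem IsNoiseResponse.hasVelocity {k : Fin n → ℝ} {Ξ : ℝ → Fin n → ℝ}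
    (h : P.IsNoiseResponse k θ ξ x Ξ) :
    HasVelocity Ξ fun t => P.errorMatrix k *ᵥ Ξ t + P.noiseForcing k θ ξ x t :=
  HasVelocity.congr h (fun _ _ => rfl) fun t _ => by unfold noiseForcing; abel

theorem boundedSignal_noiseForcing (hφ₀ : LocallyBounded P.φ₀) (hφ : LocallyBounded P.φ)
    (k : Fin n → ℝ) (hxb : BoundedSignal x) (hξ : BoundedSignal ξ) :
    BoundedSignal (P.noiseForcing k θ ξ x) := by
  have hy := P.boundedSignal_output hxb
  have hyr := P.boundedSignal_received hxb hξ
  exact ((hy.comp hφ₀).sub (hyr.comp hφ₀)).add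
    ((((hy.comp hφ).sub (hyr.comp hφ)).inner (BoundedSignal.const θ)).smul
      (BoundedSignal.const P.b)) |>.sub (hξ.smul (BoundedSignal.const k))

theorem exists_isNoiseResponse (hφ₀_meas : Measurable P.φ₀) (hφ_meas : Measurable P.φ)
    (hφ₀ : LocallyBounded P.φ₀) (hφ : LocallyBounded P.φ) (k : Fin n → ℝ)
    (hξ_meas : AEMeasurable ξ (volume.restrict (Set.Ici (0 : ℝ)))) (hξ : BoundedSignal ξ)
    (hx : P.IsTrajectory θ x) (hxb : BoundedSignal x) (Ξ₀ : Fin n → ℝ) :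
    ∃ Ξ : ℝ → Fin n → ℝ, P.IsNoiseResponse k θ ξ x Ξ ∧ Ξ 0 = Ξ₀ := by
  have hy := aemeasurable_output hx
  have hyr := aemeasurable_received hξ_meas hx
  have hmeas : AEStronglyMeasurable (P.noiseForcing k θ ξ x) (volume.restrict (Set.Ici 0)) := by
    refine (((hφ₀_meas.comp_aemeasurable hy).aestronglyMeasurable.sub
      (hφ₀_meas.comp_aemeasurable hyr).aestronglyMeasurable).add ?_).sub
      (hξ_meas.aestronglyMeasurable.smul_const k)
    exact (((hφ_meas.comp_aemeasurable hy).aestronglyMeasurable.sub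
      (hφ_meas.comp_aemeasurable hyr).aestronglyMeasurable).inner
        aestronglyMeasurable_const).smul_const P.b
  obtain ⟨Ξ, hΞ, h0⟩ := exists_linear_response (P.errorMatrix k) hmeas
    (boundedSignal_noiseForcing hφ₀ hφ k hxb hξ) Ξ₀
  exact ⟨Ξ, HasVelocity.congr hΞ (fun _ _ => rfl) fun t _ => by unfold noiseForcing; abel, h0⟩

end Signals

/-- The vector field of the observer, the estimate and the augmentation filter, for given
received signal `r`, regressor `f`, filtered regressor `ω` and drift `d`. -/
noncomputable def loopField (P : Plant n m) (k : Fin n → ℝ) (γ θs : ℝ) (r : ℝ) (d : Fin n → ℝ)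
    (f ω : EuclideanSpace ℝ (Fin m))
    (p : (Fin n → ℝ) × EuclideanSpace ℝ (Fin m) × (Fin n → ℝ)) :
    (Fin n → ℝ) × EuclideanSpace ℝ (Fin m) × (Fin n → ℝ) :=
  (P.A *ᵥ p.1 + d + inner ℝ f p.2.1 • P.b + (r - P.c ⬝ᵥ p.1) • k,
    (γ * (r - P.c ⬝ᵥ p.1 + P.c ⬝ᵥ p.2.2 - inner ℝ ω p.2.1)) • ω - switching θs p.2.1 • p.2.1,
    P.errorMatrix k *ᵥ p.2.2 + inner ℝ f p.2.1 • P.b)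

/-- For fixed signals the field is affine apart from the Lipschitz leakage. The product norm is a
maximum, so a sum of constants for the individual terms is enough. -/
theorem norm_loopField_sub_le (P : Plant n m) (k : Fin n → ℝ) {γ θs : ℝ} (hγ : 0 < γ)
    (hθs : 0 < θs) {Cf Cω : ℝ} (r : ℝ) (d : Fin n → ℝ)
    {f ω : EuclideanSpace ℝ (Fin m)} (hf : ‖f‖ ≤ Cf) (hω : ‖ω‖ ≤ Cω)
    (p q : (Fin n → ℝ) × EuclideanSpace ℝ (Fin m) × (Fin n → ℝ)) :
    ‖P.loopField k γ θs r d f ω p - P.loopField k γ θs r d f ω q‖ ≤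
      (‖mulVecCLM P.A‖ + Cf * ‖P.b‖ + ‖dotCLM P.c‖ * ‖k‖
        + (γ * (2 * ‖dotCLM P.c‖ + Cω) * Cω + 3) + ‖mulVecCLM (P.errorMatrix k)‖) * ‖p - q‖ := by
  have hCf : 0 ≤ Cf := (norm_nonneg _).trans hf
  have hCω : 0 ≤ Cω := (norm_nonneg _).trans hω
  set N := ‖p - q‖ with hN
  have hN0 : 0 ≤ N := norm_nonneg _
  have h1 : ‖p.1 - q.1‖ ≤ N := norm_fst_le (p - q)
  have h2 : ‖p.2.1 - q.2.1‖ ≤ N := (norm_fst_le (p - q).2).trans (norm_snd_le (p - q))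
  have h3 : ‖p.2.2 - q.2.2‖ ≤ N := (norm_snd_le (p - q).2).trans (norm_snd_le (p - q))
  have hA : ‖P.A *ᵥ (p.1 - q.1)‖ ≤ ‖mulVecCLM P.A‖ * N := (mulVecCLM P.A).le_opNorm_of_le h1
  have hF : ‖P.errorMatrix k *ᵥ (p.2.2 - q.2.2)‖ ≤ ‖mulVecCLM (P.errorMatrix k)‖ * N :=
    (mulVecCLM (P.errorMatrix k)).le_opNorm_of_le h3
  have hc1 : |P.c ⬝ᵥ (p.1 - q.1)| ≤ ‖dotCLM P.c‖ * N := (dotCLM P.c).le_opNorm_of_le h1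
  have hc3 : |P.c ⬝ᵥ (p.2.2 - q.2.2)| ≤ ‖dotCLM P.c‖ * N := (dotCLM P.c).le_opNorm_of_le h3
  have hfi : |inner ℝ f (p.2.1 - q.2.1)| ≤ Cf * N :=
    (abs_real_inner_le_norm _ _).trans (mul_le_mul hf h2 (norm_nonneg _) hCf)
  have hωi : |inner ℝ ω (p.2.1 - q.2.1)| ≤ Cω * N :=
    (abs_real_inner_le_norm _ _).trans (mul_le_mul hω h2 (norm_nonneg _) hCω)
  have hfb : ‖inner ℝ f (p.2.1 - q.2.1) • P.b‖ ≤ Cf * ‖P.b‖ * N := by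
    rw [norm_smul, Real.norm_eq_abs]
    nlinarith [norm_nonneg P.b, mul_le_mul_of_nonneg_right hfi (norm_nonneg P.b)]
  have hck : ‖(P.c ⬝ᵥ (p.1 - q.1)) • k‖ ≤ ‖dotCLM P.c‖ * ‖k‖ * N := by
    rw [norm_smul, Real.norm_eq_abs]
    nlinarith [norm_nonneg k, mul_le_mul_of_nonneg_right hc1 (norm_nonneg k)]
  have hadapt : ‖(γ * (-(P.c ⬝ᵥ (p.1 - q.1)) + P.c ⬝ᵥ (p.2.2 - q.2.2)
      - inner ℝ ω (p.2.1 - q.2.1))) • ω‖ ≤ γ * (2 * ‖dotCLM P.c‖ + Cω) * Cω * N := by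
    rw [norm_smul, Real.norm_eq_abs, abs_mul, abs_of_pos hγ]
    have h4 : |-(P.c ⬝ᵥ (p.1 - q.1)) + P.c ⬝ᵥ (p.2.2 - q.2.2) - inner ℝ ω (p.2.1 - q.2.1)|
        ≤ (2 * ‖dotCLM P.c‖ + Cω) * N := by
      rw [abs_le] at *
      constructor <;> linarith [hc1.1, hc1.2, hc3.1, hc3.2, hωi.1, hωi.2]
    calc γ * |-(P.c ⬝ᵥ (p.1 - q.1)) + P.c ⬝ᵥ (p.2.2 - q.2.2) - inner ℝ ω (p.2.1 - q.2.1)| * ‖ω‖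
        ≤ γ * ((2 * ‖dotCLM P.c‖ + Cω) * N) * Cω := by gcongr
      _ = _ := by ring
  have hsw : ‖switching θs p.2.1 • p.2.1 - switching θs q.2.1 • q.2.1‖ ≤ 3 * N :=
    (norm_switching_smul_sub_le hθs _ _).trans (by linarith)
  have hA0 := mul_nonneg (norm_nonneg (mulVecCLM P.A)) hN0
  have hF0 := mul_nonneg (norm_nonneg (mulVecCLM (P.errorMatrix k))) hN0
  have hfb0 : 0 ≤ Cf * ‖P.b‖ * N := by positivity
  have hck0 : 0 ≤ ‖dotCLM P.c‖ * ‖k‖ * N := by positivity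
  have had0 : 0 ≤ γ * (2 * ‖dotCLM P.c‖ + Cω) * Cω * N := by positivity
  rw [Prod.norm_def, Prod.norm_def]
  refine max_le ?_ (max_le ?_ ?_)
  · have e : (P.loopField k γ θs r d f ω p - P.loopField k γ θs r d f ω q).1
        = P.A *ᵥ (p.1 - q.1) + inner ℝ f (p.2.1 - q.2.1) • P.b - (P.c ⬝ᵥ (p.1 - q.1)) • k := by
      simp only [loopField, Prod.fst_sub, Matrix.mulVec_sub, inner_sub_right, dotProduct_sub]
      module
    rw [e]
    refine (norm_sub_le _ _).trans ?_
    have := norm_add_le (P.A *ᵥ (p.1 - q.1)) (inner ℝ f (p.2.1 - q.2.1) • P.b)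
    linarith
  · have e : (P.loopField k γ θs r d f ω p - P.loopField k γ θs r d f ω q).2.1
        = (γ * (-(P.c ⬝ᵥ (p.1 - q.1)) + P.c ⬝ᵥ (p.2.2 - q.2.2)
          - inner ℝ ω (p.2.1 - q.2.1))) • ω
          - (switching θs p.2.1 • p.2.1 - switching θs q.2.1 • q.2.1) := by
      simp only [loopField, Prod.fst_sub, Prod.snd_sub, inner_sub_right, dotProduct_sub]
      module
    rw [e]
    refine (norm_sub_le _ _).trans ?_
    linarith
  · have e : (P.loopField k γ θs r d f ω p - P.loopField k γ θs r d f ω q).2.2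
        = P.errorMatrix k *ᵥ (p.2.2 - q.2.2) + inner ℝ f (p.2.1 - q.2.1) • P.b := by
      simp only [loopField, Prod.snd_sub, Matrix.mulVec_sub, inner_sub_right]
      module
    rw [e]
    refine (norm_add_le _ _).trans ?_
    linarith

/-- The regressor filters do not depend on the rest of the loop, so they are solved first. With `ω̄`
a known bounded signal the remaining equations are globally Lipschitz; with `Ω` among the unknowns,
`ω̄ ω̄ᵀ θ̂` would be cubic. -/
theorem exists_isClosedLoop {P : Plant n m} {θ : EuclideanSpace ℝ (Fin m)} {ξ : ℝ → ℝ}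
    {x : ℝ → Fin n → ℝ} (hφ₀_meas : Measurable P.φ₀) (hφ_meas : Measurable P.φ)
    (hφ₀ : LocallyBounded P.φ₀) (hφ : LocallyBounded P.φ) {k : Fin n → ℝ}
    (hF : IsHurwitz (P.errorMatrix k))
    (hξ_meas : AEMeasurable ξ (volume.restrict (Set.Ici (0 : ℝ)))) (hξ : BoundedSignal ξ)
    {γ θs : ℝ} (hγ : 0 < γ) (hθs : 0 < θs)
    (hx : P.IsTrajectory θ x) (hxb : BoundedSignal x)
    (xh₀ : Fin n → ℝ) (θh₀ : EuclideanSpace ℝ (Fin m)) (ζ₀ : Fin n → ℝ) (Ω₀ : Fin m → Fin n → ℝ) :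
    ∃ (xh : ℝ → Fin n → ℝ) (θh : ℝ → EuclideanSpace ℝ (Fin m)) (ζ : ℝ → Fin n → ℝ)
      (Ω : Fin m → ℝ → Fin n → ℝ),
      P.IsClosedLoop k γ θs ξ x xh θh ζ Ω ∧
        xh 0 = xh₀ ∧ θh 0 = θh₀ ∧ ζ 0 = ζ₀ ∧ ∀ i, Ω i 0 = Ω₀ i := by
  set μ := volume.restrict (Set.Ici (0 : ℝ)) with hμ
  have hyr := aemeasurable_received hξ_meas hx
  have hyrb := P.boundedSignal_received hxb hξ
  have hfm : AEStronglyMeasurable (fun t => P.φ (P.received ξ x t)) μ :=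
    (hφ_meas.comp_aemeasurable hyr).aestronglyMeasurable
  have hdm : AEStronglyMeasurable (fun t => P.φ₀ (P.received ξ x t)) μ :=
    (hφ₀_meas.comp_aemeasurable hyr).aestronglyMeasurable
  have hfb := hyrb.comp hφ
  have hdb := hyrb.comp hφ₀
  have hΩex (i : Fin m) : ∃ z : ℝ → Fin n → ℝ,
      IsFilterState (P.errorMatrix k) P.b (fun t => P.φ (P.received ξ x t) i) z ∧ z 0 = Ω₀ i := by
    refine exists_linear_response (P.errorMatrix k) (w := fun t => P.φ (P.received ξ x t) i • P.b)
      ?_ ?_ (Ω₀ i)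
    · exact (((EuclideanSpace.proj i : EuclideanSpace ℝ (Fin m) →L[ℝ] ℝ).continuous
        ).comp_aestronglyMeasurable hfm).smul_const P.b
    · exact (hfb.clm (EuclideanSpace.proj i : EuclideanSpace ℝ (Fin m) →L[ℝ] ℝ)).smul
        (BoundedSignal.const P.b)
  choose Ω hΩ hΩ0 using hΩex
  have hΩb (i : Fin m) : BoundedSignal (Ω i) := hF.boundedSignal (hΩ i)
    ((hfb.clm (EuclideanSpace.proj i : EuclideanSpace ℝ (Fin m) →L[ℝ] ℝ)).smul
        (BoundedSignal.const P.b))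
  have hωb := P.boundedSignal_filteredRegressor hΩb
  have hωm : AEStronglyMeasurable (P.filteredRegressor Ω) μ := by
    have h1 : ContinuousOn (fun t (i : Fin m) => P.output (Ω i) t) (Set.Ici 0) :=
      continuousOn_pi.2 fun i =>
        (dotCLM P.c).continuous.comp_continuousOn (HasVelocity.continuousOn (hΩ i))
    exact ((EuclideanSpace.equiv (Fin m) ℝ).symm.continuous.comp_continuousOn h1
      ).aestronglyMeasurable measurableSet_Ici
  have hrm : AEStronglyMeasurable (P.received ξ x) μ := hyr.aestronglyMeasurable
  obtain ⟨Cf, hCf⟩ := hfb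
  obtain ⟨Cω, hCω⟩ := hωb
  obtain ⟨Cd, hCd⟩ := hdb
  obtain ⟨Cr, hCr⟩ := hyrb
  have hCr0 : 0 ≤ Cr := (norm_nonneg _).trans (hCr 0 le_rfl)
  have hCω0 : 0 ≤ Cω := (norm_nonneg _).trans (hCω 0 le_rfl)
  have hCd0 : 0 ≤ Cd := (norm_nonneg _).trans (hCd 0 le_rfl)
  have hmeas (z : ℝ → (Fin n → ℝ) × EuclideanSpace ℝ (Fin m) × (Fin n → ℝ)) (hz : Continuous z) :
      AEStronglyMeasurable (fun t => P.loopField k γ θs (P.received ξ x t) (P.φ₀ (P.received ξ x t))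
        (P.φ (P.received ξ x t)) (P.filteredRegressor Ω t) (z t)) μ := by
    have h1 : Continuous fun t => (z t).1 := continuous_fst.comp hz
    have h2 : Continuous fun t => (z t).2.1 := continuous_fst.comp (continuous_snd.comp hz)
    have h3 : Continuous fun t => (z t).2.2 := continuous_snd.comp (continuous_snd.comp hz)
    have hc1 : AEStronglyMeasurable (fun t => P.c ⬝ᵥ (z t).1) μ :=
      ((dotCLM P.c).continuous.comp h1).aestronglyMeasurable
    have hc3 : AEStronglyMeasurable (fun t => P.c ⬝ᵥ (z t).2.2) μ :=
      ((dotCLM P.c).continuous.comp h3).aestronglyMeasurable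
    have hfi : AEStronglyMeasurable
        (fun t => inner ℝ (P.φ (P.received ξ x t)) (z t).2.1 • P.b) μ :=
      (hfm.inner h2.aestronglyMeasurable).smul_const P.b
    refine AEStronglyMeasurable.prodMk ?_ (AEStronglyMeasurable.prodMk ?_ ?_)
    · exact (((((mulVecCLM P.A).continuous.comp h1).aestronglyMeasurable.add hdm).add hfi)).add
        ((hrm.sub hc1).smul_const k)
    · refine AEStronglyMeasurable.sub ?_
        ((lipschitzWith_switching_smul hθs).continuous.comp h2).aestronglyMeasurable
      exact ((((hrm.sub hc1).add hc3).sub (hωm.inner h2.aestronglyMeasurable)).const_mul γ).smul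
        hωm
    · exact ((mulVecCLM (P.errorMatrix k)).continuous.comp h3).aestronglyMeasurable.add hfi
  have hbound (t : ℝ) (ht : 0 ≤ t) :
      ‖P.loopField k γ θs (P.received ξ x t) (P.φ₀ (P.received ξ x t))
        (P.φ (P.received ξ x t)) (P.filteredRegressor Ω t) 0‖
        ≤ Cd + Cr * ‖k‖ + γ * Cr * Cω := by
    have hk : ‖P.received ξ x t • k‖ ≤ Cr * ‖k‖ := by
      rw [norm_smul]; exact mul_le_mul_of_nonneg_right (hCr t ht) (norm_nonneg _)
    have ha : ‖(γ * P.received ξ x t) • P.filteredRegressor Ω t‖ ≤ γ * Cr * Cω := by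
      rw [norm_smul, norm_mul, Real.norm_of_nonneg hγ.le]
      exact mul_le_mul (mul_le_mul_of_nonneg_left (hCr t ht) hγ.le) (hCω t ht) (norm_nonneg _)
        (by positivity)
    have hk0 : 0 ≤ Cr * ‖k‖ := by positivity
    have ha0 : 0 ≤ γ * Cr * Cω := by positivity
    rw [Prod.norm_def, Prod.norm_def]
    refine max_le ?_ (max_le ?_ ?_)
    · simp only [loopField, Prod.fst_zero, Prod.snd_zero, Matrix.mulVec_zero, inner_zero_right,
        zero_smul, dotProduct_zero, zero_add, add_zero, sub_zero]
      refine (norm_add_le _ _).trans ?_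
      linarith [hCd t ht]
    · simp only [loopField, Prod.fst_zero, Prod.snd_zero, inner_zero_right,
        smul_zero, dotProduct_zero, add_zero, sub_zero]
      linarith
    · simp only [loopField, Prod.fst_zero, Prod.snd_zero, Matrix.mulVec_zero, inner_zero_right,
        zero_smul, add_zero, norm_zero]
      linarith
  obtain ⟨z, hz, hz0⟩ := exists_hasVelocity
    (fun t p => P.loopField k γ θs (P.received ξ x t) (P.φ₀ (P.received ξ x t))
      (P.φ (P.received ξ x t)) (P.filteredRegressor Ω t) p)
    hmeas
    (fun t ht p q => P.norm_loopField_sub_le k hγ hθs _ _ (hCf t ht) (hCω t ht) p q)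
    hbound (xh₀, θh₀, ζ₀)
  refine ⟨fun t => (z t).1, fun t => (z t).2.1, fun t => (z t).2.2, Ω, ⟨?_, ?_, hΩ, ?_⟩,
    by simp only [hz0], by simp only [hz0], by simp only [hz0], hΩ0⟩
  · exact hz.clm (ContinuousLinearMap.fst ℝ _ _)
  · exact hz.clm ((ContinuousLinearMap.snd ℝ _ _).comp (ContinuousLinearMap.snd ℝ _ _))
  · exact hz.clm ((ContinuousLinearMap.fst ℝ _ _).comp (ContinuousLinearMap.snd ℝ _ _))

end Plant

end AdaptiveSync

namespace AdaptiveSync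

variable {n m : ℕ}

/-! ### The adaptation law -/

/-- So far out, `‖θh‖ > 2 * θs` and the leakage gain is one. Its contribution `2⟨θ̃, θh⟩` equals
`‖θ‖² - ‖θ̃‖² - ‖θh‖²`, and `-2q² - 2qδ ≤ δ²/2` by completing the square. -/
theorem lyapunovRate_le_of_large {γ θs : ℝ} (hγ : 0 < γ) (hθs : 0 < θs)
    (θ θh ω : EuclideanSpace ℝ (Fin m)) (δ : ℝ) (hlarge : ‖θ‖ + 2 * θs < ‖θ - θh‖) :
    -2 * inner ℝ (θ - θh) ((γ * (inner ℝ ω (θ - θh) + δ)) • ω - switching θs θh • θh)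
      ≤ γ * (δ ^ 2 / 2) + ‖θ‖ ^ 2 - ‖θ - θh‖ ^ 2 := by
  have h1 : 2 * θs < ‖θh‖ := by linarith [norm_sub_le θ θh]
  have h2 : switching θs θh = 1 := by
    unfold switching
    rw [if_neg (by linarith), if_neg (by linarith)]
  have h3 : ‖θ‖ ^ 2 = ‖θ - θh‖ ^ 2 + 2 * inner ℝ (θ - θh) θh + ‖θh‖ ^ 2 := by
    rw [← norm_add_sq_real, sub_add_cancel]
  rw [h2, one_smul, inner_sub_right, inner_smul_right, real_inner_comm ω (θ - θh)]
  set q := inner ℝ ω (θ - θh)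
  nlinarith [mul_nonneg hγ.le (sq_nonneg (2 * q + δ)), sq_nonneg ‖θh‖]

/-- Where the leakage is active, `‖θh‖ ≥ θs`, so `⟨θ̃, θh⟩ ≤ -(θs - ‖θ‖)‖θh‖`. Here the square is
completed as `-2q² - 2qδ ≤ -q² + δ²`, keeping part of the dissipation. -/
theorem lyapunovRate_le_neg {γ θs : ℝ} (hγ : 0 < γ) (hθs : 0 < θs)
    (θ θh ω : EuclideanSpace ℝ (Fin m)) (δ : ℝ) :
    -2 * inner ℝ (θ - θh) ((γ * (inner ℝ ω (θ - θh) + δ)) • ω - switching θs θh • θh)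
      ≤ -(γ * (inner ℝ ω (θ - θh) * inner ℝ ω (θ - θh))
          + 2 * (θs - ‖θ‖) * ‖switching θs θh • θh‖) + γ * δ ^ 2 := by
  have h1 : inner ℝ (θ - θh) (switching θs θh • θh)
      ≤ -((θs - ‖θ‖) * ‖switching θs θh • θh‖) := by
    rw [norm_smul, Real.norm_of_nonneg (switching_nonneg hθs θh), inner_smul_right]
    rcases lt_or_ge ‖θh‖ θs with hlt | hge
    · have h2 : switching θs θh = 0 := by
        unfold switching
        rw [if_pos hlt]
      rw [h2]; simp
    · have h3 : inner ℝ (θ - θh) θh ≤ -((θs - ‖θ‖) * ‖θh‖) := by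
        rw [inner_sub_left, real_inner_self_eq_norm_sq]
        nlinarith [real_inner_le_norm θ θh, norm_nonneg θh]
      have := mul_le_mul_of_nonneg_left h3 (switching_nonneg hθs θh)
      linarith
  rw [inner_sub_right, inner_smul_right, real_inner_comm ω (θ - θh)]
  set q := inner ℝ ω (θ - θh)
  nlinarith [mul_nonneg hγ.le (sq_nonneg (q + δ))]

section Adaptation

variable {γ θs : ℝ} {θ : EuclideanSpace ℝ (Fin m)} {θh ω : ℝ → EuclideanSpace ℝ (Fin m)}
  {δ : ℝ → ℝ}

theorem hasVelocity_lyapunov {ν : ℝ → EuclideanSpace ℝ (Fin m)} (h : HasVelocity θh ν) :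
    HasVelocity (fun t => ‖θ - θh t‖ ^ 2) fun t => -2 * inner ℝ (θ - θh t) (ν t) := by
  have h1 := (HasVelocity.const θ).sub h
  refine (h1.inner h1).congr (fun t _ => real_inner_self_eq_norm_sq _) fun t _ => ?_
  rw [zero_sub, inner_neg_left, inner_neg_right, real_inner_comm]
  ring

/-- Above the level `M` the leakage is saturated and outweighs the disturbance, and `M` includes the
initial value of the Lyapunov function. No bound on `ω` is needed, since the regression error enters
through a completed square. -/
theorem boundedSignal_estimate (hγ : 0 < γ) (hθs : 0 < θs)
    (h : HasVelocity θh fun t =>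
      (γ * (inner ℝ (ω t) (θ - θh t) + δ t)) • ω t - switching θs (θh t) • θh t)
    (hδ : BoundedSignal δ) : BoundedSignal θh := by
  obtain ⟨D, hD⟩ := hδ
  set M := max (max ((‖θ‖ + 2 * θs) ^ 2) (γ * D ^ 2 + ‖θ‖ ^ 2)) (‖θ - θh 0‖ ^ 2) with hM
  have hV := (hasVelocity_lyapunov (θ := θ) h).le_of_velocity_nonpos (M := M) le_rfl
    (Filter.Eventually.of_forall fun t ht hlt => by
      have h1 : (‖θ‖ + 2 * θs) ^ 2 < ‖θ - θh t‖ ^ 2 :=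
        ((le_max_left _ _).trans (le_max_left _ _)).trans_lt hlt
      have h2 : γ * D ^ 2 + ‖θ‖ ^ 2 < ‖θ - θh t‖ ^ 2 :=
        ((le_max_right _ _).trans (le_max_left _ _)).trans_lt hlt
      have h3 := lyapunovRate_le_of_large hγ hθs θ (θh t) (ω t) (δ t)
        (lt_of_pow_lt_pow_left₀ 2 (norm_nonneg _) h1)
      have h4 : δ t ^ 2 ≤ D ^ 2 := by
        rw [← sq_abs]
        exact pow_le_pow_left₀ (abs_nonneg _) (hD t ht) 2
      nlinarith [mul_le_mul_of_nonneg_left h4 hγ.le, mul_nonneg hγ.le (sq_nonneg (δ t))])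
    (le_max_right _ _)
  refine ⟨‖θ‖ + √M, fun t ht => ?_⟩
  have h1 : ‖θ - θh t‖ ≤ √M := Real.le_sqrt_of_sq_le (hV t ht)
  have h2 : ‖θh t‖ ≤ ‖θ‖ + ‖θ - θh t‖ := by
    calc ‖θh t‖ = ‖θ - (θ - θh t)‖ := by rw [sub_sub_cancel]
      _ ≤ _ := norm_sub_le _ _
  linarith

/-- Boundedness makes the essential supremum finite; an infinite one would be sent to `0` by
`toReal`. -/
theorem ae_abs_le_supNorm {d : ℝ → ℝ} (hd : BoundedSignal d) :
    ∀ᵐ t, 0 ≤ t → |d t| ≤ supNorm d := by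
  obtain ⟨C, hC⟩ := hd
  have hfin : eLpNormEssSup d (volume.restrict (Set.Ici (0 : ℝ))) < ⊤ :=
    eLpNormEssSup_lt_top_of_ae_bound (C := C)
      ((ae_restrict_iff' measurableSet_Ici).2 (Filter.Eventually.of_forall hC))
  have h1 := (ae_restrict_iff' measurableSet_Ici).1
    (ae_le_eLpNormEssSup (f := d) (μ := volume.restrict (Set.Ici (0 : ℝ))))
  filter_upwards [h1] with t ht h0
  have h2 := ENNReal.toReal_mono hfin.ne (ht h0)
  rw [supNorm, eLpNorm_exponent_top]
  simpa using h2

/-- Radial projection onto the ball, with `√(R + η) ≤ √R + √η`. -/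
theorem infDist_ball_le {R η : ℝ} (hR : 0 ≤ R) (hη : 0 ≤ η) {v : EuclideanSpace ℝ (Fin m)}
    (hv : ‖v‖ ^ 2 ≤ R + η) :
    Metric.infDist v {w : EuclideanSpace ℝ (Fin m) | ‖w‖ ^ 2 ≤ R} ≤ √η := by
  rcases le_or_gt (‖v‖ ^ 2) R with hle | hlt
  · have hmem : v ∈ {w : EuclideanSpace ℝ (Fin m) | ‖w‖ ^ 2 ≤ R} := hle
    rw [Metric.infDist_zero_of_mem hmem]
    positivity
  · have hv0 : 0 < ‖v‖ := by
      by_contra! h0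
      have : ‖v‖ = 0 := le_antisymm h0 (norm_nonneg _)
      rw [this] at hlt
      simp at hlt
      linarith
    have hsq : √R ≤ ‖v‖ := Real.sqrt_le_iff.2 ⟨hv0.le, hlt.le⟩
    have hmem : (√R / ‖v‖) • v ∈ {w : EuclideanSpace ℝ (Fin m) | ‖w‖ ^ 2 ≤ R} := by
      rw [Set.mem_ofPred_eq, norm_smul, Real.norm_of_nonneg (by positivity),
        div_mul_cancel₀ _ hv0.ne', Real.sq_sqrt hR]
    refine (Metric.infDist_le_dist_of_mem hmem).trans ?_
    have h1 : v - (√R / ‖v‖) • v = (1 - √R / ‖v‖) • v := by module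
    rw [dist_eq_norm, h1, norm_smul, Real.norm_of_nonneg (by
      rw [sub_nonneg]; exact (div_le_one hv0).2 hsq), sub_mul, one_mul, div_mul_cancel₀ _ hv0.ne']
    have h2 : ‖v‖ ≤ √(R + η) := Real.le_sqrt_of_sq_le hv
    have h3 : √(R + η) ≤ √R + √η := Real.sqrt_le_iff.2 ⟨by positivity, by
      nlinarith [Real.sq_sqrt hR, Real.sq_sqrt hη,
        mul_nonneg (Real.sqrt_nonneg R) (Real.sqrt_nonneg η)]⟩
    linarith

theorem tendsto_infDist_residualSet (hγ : 0 < γ) (hθs : 0 < θs) {d e : ℝ → ℝ}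
    (h : HasVelocity θh fun t =>
      (γ * (inner ℝ (ω t) (θ - θh t) + (d t + e t))) • ω t - switching θs (θh t) • θh t)
    (hd : BoundedSignal d) (he : Tendsto e atTop (𝓝 0)) :
    Tendsto (fun t => Metric.infDist (θ - θh t) (residualSet γ θs θ d)) atTop (𝓝 0) := by
  set R := max ((‖θ‖ + 2 * θs) ^ 2) (γ * supNorm d ^ 2 + ‖θ‖ ^ 2) with hR
  have hR0 : 0 ≤ R := (sq_nonneg _).trans (le_max_left _ _)
  have key : ∀ η > 0, ∀ᶠ t in atTop, ‖θ - θh t‖ ^ 2 ≤ R + η := by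
    intro η hη
    have he2 : Tendsto (fun t => γ * e t ^ 2) atTop (𝓝 0) := by
      simpa using (he.pow 2).const_mul γ
    obtain ⟨N, hN⟩ := eventually_atTop.1 (he2.eventually (Iio_mem_nhds (half_pos hη)))
    refine (hasVelocity_lyapunov (θ := θ) h).eventually_le_of_velocity_le (le_max_right N 0)
      (half_pos hη) (fun t => by positivity) ?_
    filter_upwards [ae_abs_le_supNorm hd] with t htd ht hlt
    have h0 : 0 ≤ t := (le_max_right N 0).trans ht
    have h1 : (‖θ‖ + 2 * θs) ^ 2 < ‖θ - θh t‖ ^ 2 :=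
      (le_max_left _ _).trans_lt ((le_add_of_nonneg_right hη.le).trans_lt hlt)
    have h2 : γ * supNorm d ^ 2 + ‖θ‖ ^ 2 + η < ‖θ - θh t‖ ^ 2 :=
      (add_le_add_left (le_max_right _ _) η).trans_lt hlt
    have h3 := lyapunovRate_le_of_large hγ hθs θ (θh t) (ω t) (d t + e t)
      (lt_of_pow_lt_pow_left₀ 2 (norm_nonneg _) h1)
    have h4 : d t ^ 2 ≤ supNorm d ^ 2 := by
      rw [← sq_abs (d t)]
      exact pow_le_pow_left₀ (abs_nonneg _) (htd h0) 2
    have h5 : γ * e t ^ 2 < η / 2 := hN t ((le_max_left N 0).trans ht)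
    -- The factor `1 / 2` left by completing the square absorbs the cross term, so `supNorm d ^ 2`
    -- enters the residual set with coefficient exactly `γ`. Above `R + η` the rate is then at most
    -- `-η / 2`.
    have h6 : (d t + e t) ^ 2 / 2 ≤ d t ^ 2 + e t ^ 2 := by nlinarith [sq_nonneg (d t - e t)]
    have h7 := mul_le_mul_of_nonneg_left h6 hγ.le
    have h8 := mul_le_mul_of_nonneg_left h4 hγ.le
    linarith
  rw [Metric.tendsto_atTop]
  intro ε hε
  obtain ⟨N, hN⟩ := eventually_atTop.1 (key ((ε / 2) ^ 2) (by positivity))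
  refine ⟨N, fun t ht => ?_⟩
  have h1 := infDist_ball_le hR0 (sq_nonneg (ε / 2)) (hN t ht)
  rw [Real.sqrt_sq (by positivity)] at h1
  rw [dist_zero_right, Real.norm_of_nonneg Metric.infDist_nonneg]
  exact h1.trans_lt (by linarith)

/-- For an exponentially decaying disturbance, the regression error and the leakage term tend to
zero. -/
theorem tendsto_zero_of_exp_decay (hγ : 0 < γ) (hθs : 0 < θs) (hθ : ‖θ‖ < θs)
    (h : HasVelocity θh fun t =>
      (γ * (inner ℝ (ω t) (θ - θh t) + δ t)) • ω t - switching θs (θh t) • θh t)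
    {ω' : ℝ → EuclideanSpace ℝ (Fin m)} (hω : HasVelocity ω ω')
    (hωb : BoundedSignal ω) (hωb' : BoundedSignal ω')
    {a C : ℝ} (ha : 0 < a) (hδ : ∀ t, 0 ≤ t → |δ t| ≤ C * Real.exp (-a * t)) :
    Tendsto (fun t => inner ℝ (ω t) (θ - θh t)) atTop (𝓝 0) ∧
      Tendsto (fun t => switching θs (θh t) • θh t) atTop (𝓝 0) := by
  have hC0 : 0 ≤ C := by
    have := (abs_nonneg _).trans (hδ 0 le_rfl)
    simpa using this
  have hδb : BoundedSignal δ := ⟨C, fun t ht => (hδ t ht).trans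
    (mul_le_of_le_one_right hC0 (Real.exp_le_one_iff.2 (by nlinarith)))⟩
  have hθb := boundedSignal_estimate hγ hθs h hδb
  have hθtb : BoundedSignal fun t => θ - θh t := (BoundedSignal.const θ).sub hθb
  have hqb := hωb.inner hθtb
  have hswb : BoundedSignal fun t => switching θs (θh t) • θh t := by
    obtain ⟨B, hB⟩ := hθb
    refine ⟨B, fun t ht => ?_⟩
    rw [norm_smul, Real.norm_of_nonneg (switching_nonneg hθs _)]
    exact (mul_le_of_le_one_left (norm_nonneg _) (switching_le_one hθs _)).trans (hB t ht)
  have hνb := (((BoundedSignal.const γ).smul (hqb.add hδb)).smul hωb).sub hswb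
  have hθt := (HasVelocity.const θ).sub h
  have hq := hω.inner hθt
  have hqb' := (hωb'.inner hθtb).add
    (hωb.inner ((BoundedSignal.const (0 : EuclideanSpace ℝ (Fin m))).sub hνb))
  have hqq : UniformContinuousOn
      (fun t => inner ℝ (ω t) (θ - θh t) * inner ℝ (ω t) (θ - θh t)) (Set.Ici 0) :=
    (hq.mul hq).uniformContinuousOn ((hqb'.smul hqb).add (hqb.smul hqb'))
  have hsw : UniformContinuousOn (fun t => ‖switching θs (θh t) • θh t‖) (Set.Ici 0) :=
    uniformContinuous_norm.comp_uniformContinuousOn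
      ((lipschitzWith_switching_smul hθs).uniformContinuous.comp_uniformContinuousOn
        (h.uniformContinuousOn hνb))
  -- `W` is the dissipation rate. It is uniformly continuous because `q` and the estimate have
  -- bounded velocities and the leakage is Lipschitz.
  set W : ℝ → ℝ := fun t => γ * (inner ℝ (ω t) (θ - θh t) * inner ℝ (ω t) (θ - θh t))
    + 2 * (θs - ‖θ‖) * ‖switching θs (θh t) • θh t‖ with hW
  have hWuc : UniformContinuousOn W (Set.Ici 0) := uniformContinuousOn_add
    ((ContinuousLinearMap.mul ℝ ℝ γ).uniformContinuous.comp_uniformContinuousOn hqq)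
    ((ContinuousLinearMap.mul ℝ ℝ (2 * (θs - ‖θ‖))).uniformContinuous.comp_uniformContinuousOn hsw)
  have hκ : 0 < 2 * (θs - ‖θ‖) := by linarith
  have hW1 (t : ℝ) : 0 ≤ γ * (inner ℝ (ω t) (θ - θh t) * inner ℝ (ω t) (θ - θh t)) :=
    mul_nonneg hγ.le (mul_self_nonneg _)
  have hW2 (t : ℝ) : 0 ≤ 2 * (θs - ‖θ‖) * ‖switching θs (θh t) • θh t‖ :=
    mul_nonneg hκ.le (norm_nonneg _)
  have hV := hasVelocity_lyapunov (θ := θ) h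
  have hlim : Tendsto W atTop (𝓝 0) := by
    refine tendsto_zero_of_integral_bounded hWuc (fun t _ => add_nonneg (hW1 t) (hW2 t))
      -- The initial Lyapunov value plus the integral of `γ C² exp (-2 a s)` over the half-line.
      (C := ‖θ - θh 0‖ ^ 2 + γ * C ^ 2 / (2 * a)) fun t ht => ?_
    have hsub : Set.uIcc 0 t ⊆ Set.Ici 0 := by
      rw [Set.uIcc_of_le ht]; exact fun s hs => hs.1
    have hWi : IntervalIntegrable W volume 0 t :=
      (hWuc.continuousOn.mono hsub).intervalIntegrable
    have hEi : IntervalIntegrable (fun s => γ * C ^ 2 * Real.exp (-(2 * a) * s)) volume 0 t :=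
      Continuous.intervalIntegrable (by fun_prop) _ _
    have h1 := intervalIntegral.integral_mono_on ht (hV t ht).1 (hEi.sub hWi) fun s hs => by
      have h2 := lyapunovRate_le_neg hγ hθs θ (θh s) (ω s) (δ s)
      have h3 : δ s ^ 2 ≤ C ^ 2 * Real.exp (-(2 * a) * s) := by
        have := pow_le_pow_left₀ (abs_nonneg _) (hδ s hs.1) 2
        have he : Real.exp (-(2 * a) * s) = Real.exp (-a * s) ^ 2 := by
          rw [sq, ← Real.exp_add]; ring_nf
        rwa [sq_abs, mul_pow, ← he] at this
      have h4 := mul_le_mul_of_nonneg_left h3 hγ.le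
      simp only [hW]
      linarith
    rw [intervalIntegral.integral_sub hEi hWi, ← hV.sub_eq_integral le_rfl ht] at h1
    have h5 : ∫ s in (0 : ℝ)..t, γ * C ^ 2 * Real.exp (-(2 * a) * s)
        = γ * C ^ 2 / (2 * a) * (1 - Real.exp (-(2 * a) * t)) := by
      have hder (r : ℝ) : HasDerivAt (fun r => -(γ * C ^ 2 / (2 * a)) * Real.exp (-(2 * a) * r))
          (γ * C ^ 2 * Real.exp (-(2 * a) * r)) r := by
        have := (((hasDerivAt_id r).const_mul (-(2 * a))).exp).const_mul (-(γ * C ^ 2 / (2 * a)))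
        refine this.congr_deriv ?_
        simp only [id]
        field_simp
      rw [intervalIntegral.integral_eq_sub_of_hasDerivAt (fun r _ => hder r) hEi]
      simp; ring
    have h6 : γ * C ^ 2 / (2 * a) * (1 - Real.exp (-(2 * a) * t)) ≤ γ * C ^ 2 / (2 * a) :=
      mul_le_of_le_one_right (by positivity) (by linarith [Real.exp_pos (-(2 * a) * t)])
    have h7 : 0 ≤ ‖θ - θh t‖ ^ 2 := by positivity
    linarith
  constructor
  · have h1 : Tendsto (fun t => γ * (inner ℝ (ω t) (θ - θh t) * inner ℝ (ω t) (θ - θh t)))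
        atTop (𝓝 0) :=
      squeeze_zero hW1 (fun t => le_add_of_nonneg_right (hW2 t)) hlim
    have h2 : Tendsto (fun t => √(inner ℝ (ω t) (θ - θh t) * inner ℝ (ω t) (θ - θh t)))
        atTop (𝓝 0) := by
      have h3 := h1.const_mul γ⁻¹
      rw [mul_zero] at h3
      have h4 := (Real.continuous_sqrt.tendsto' 0 0 Real.sqrt_zero).comp h3
      refine h4.congr fun t => ?_
      simp only [Function.comp]
      rw [inv_mul_cancel_left₀ hγ.ne']
    simp only [Real.sqrt_mul_self_eq_abs] at h2
    exact (tendsto_zero_iff_abs_tendsto_zero _).2 h2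
  · have h1 : Tendsto (fun t => 2 * (θs - ‖θ‖) * ‖switching θs (θh t) • θh t‖) atTop (𝓝 0) :=
      squeeze_zero hW2 (fun t => le_add_of_nonneg_left (hW1 t)) hlim
    have h3 := h1.const_mul (2 * (θs - ‖θ‖))⁻¹
    rw [mul_zero] at h3
    refine tendsto_zero_iff_norm_tendsto_zero.2 (h3.congr fun t => ?_)
    rw [inv_mul_cancel_left₀ hκ.ne']

end Adaptation

/-! ### Persistent excitation -/

theorem PersistentlyExciting.le_integral {f : ℝ → EuclideanSpace ℝ (Fin m)}
    (hf : PersistentlyExciting f) : ∃ α T : ℝ, 0 < α ∧ 0 < T ∧ ∀ t, 0 ≤ t →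
      ∀ v : EuclideanSpace ℝ (Fin m), α * ‖v‖ ^ 2 ≤ ∫ s in t..(t + T), inner ℝ (f s) v ^ 2 := by
  obtain ⟨hmeas, ⟨C, hC⟩, α, T, hα, hT, hpsd⟩ := hf
  refine ⟨α, T, hα, hT, fun t ht v => ?_⟩
  have hm : AEMeasurable f (volume.restrict (Set.Ici 0)) :=
    (aemeasurable_restrict_iff_comap_subtype measurableSet_Ici).2 hmeas.aemeasurable
  have hmi (i : Fin m) : AEStronglyMeasurable (fun s => f s i) (volume.restrict (Set.Ici 0)) :=
    (EuclideanSpace.proj i : EuclideanSpace ℝ (Fin m) →L[ℝ] ℝ).continuous.comp_aestronglyMeasurable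
      hm.aestronglyMeasurable
  have hint (i j : Fin m) : IntervalIntegrable (fun s => f s i * f s j) volume t (t + T) := by
    refine (intervalIntegrable_const (c := C * C)).mono_fun ?_ ?_
    · refine ((hmi i).mul (hmi j)).mono_measure (Measure.restrict_mono (fun s hs => ?_) le_rfl)
      rw [Set.uIoc_of_le (by linarith)] at hs
      exact ht.trans hs.1.le
    · refine (ae_restrict_iff' measurableSet_uIoc).2 (Filter.Eventually.of_forall fun s hs => ?_)
      rw [Set.uIoc_of_le (by linarith)] at hs
      have hs0 : 0 ≤ s := ht.trans hs.1.le
      have hC0 : 0 ≤ C := (norm_nonneg _).trans (hC s hs0)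
      beta_reduce
      rw [Real.norm_of_nonneg (mul_nonneg hC0 hC0), norm_mul]
      exact mul_le_mul ((PiLp.norm_apply_le _ i).trans (hC s hs0))
        ((PiLp.norm_apply_le _ j).trans (hC s hs0)) (norm_nonneg _) hC0
  have h1 := (hpsd t ht).dotProduct_mulVec_nonneg (v.ofLp)
  rw [Matrix.sub_mulVec, dotProduct_sub, Matrix.smul_mulVec, Matrix.one_mulVec, dotProduct_smul,
    sub_nonneg] at h1
  have h2 : star v.ofLp ⬝ᵥ v.ofLp = ‖v‖ ^ 2 := by
    rw [EuclideanSpace.real_norm_sq_eq]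
    simp [dotProduct, sq]
  have h3 : star v.ofLp ⬝ᵥ ((Matrix.of fun i j : Fin m => ∫ s in t..(t + T), f s i * f s j) *ᵥ
      v.ofLp) = ∫ s in t..(t + T), inner ℝ (f s) v ^ 2 := by
    have h4 (s : ℝ) : inner ℝ (f s) v ^ 2 = ∑ i, ∑ j, v i * v j * (f s i * f s j) := by
      rw [PiLp.inner_apply, sq, Finset.sum_mul_sum]
      refine Finset.sum_congr rfl fun i _ => Finset.sum_congr rfl fun j _ => ?_
      simp only [RCLike.inner_apply, conj_trivial]
      ring
    simp only [h4]
    have hint' (i : Fin m) : IntervalIntegrable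
        (fun s => ∑ j, v i * v j * (f s i * f s j)) volume t (t + T) := by
      simpa only [Finset.sum_fn] using IntervalIntegrable.sum Finset.univ fun j _ =>
        (hint i j).const_mul (v i * v j)
    rw [intervalIntegral.integral_finsetSum fun i _ => hint' i]
    simp only [dotProduct, Matrix.mulVec, Matrix.of_apply, Finset.mul_sum]
    refine Finset.sum_congr rfl fun i _ => ?_
    rw [intervalIntegral.integral_finsetSum fun j _ => (hint i j).const_mul _]
    refine Finset.sum_congr rfl fun j _ => ?_
    rw [intervalIntegral.integral_const_mul]
    simp
    ring
  rw [h2, h3] at h1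
  simpa using h1

/-- Over a window of fixed length `T` the vector `ϑ` is nearly frozen, so `⟨f s, ϑ t⟩` is small
throughout the window that starts at `t`. Excitation then bounds `‖ϑ t‖`. -/
theorem PersistentlyExciting.tendsto_zero {f ϑ ν : ℝ → EuclideanSpace ℝ (Fin m)}
    (hf : PersistentlyExciting f) (hϑ : HasVelocity ϑ ν) (hν : Tendsto ν atTop (𝓝 0))
    (hg : Tendsto (fun t => inner ℝ (f t) (ϑ t)) atTop (𝓝 0)) :
    Tendsto (fun t => ‖ϑ t‖) atTop (𝓝 0) := by
  obtain ⟨α, T, hα, hT, hPE⟩ := hf.le_integral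
  obtain ⟨C, hC⟩ := hf.2.1
  have hC0 : 0 ≤ C := (norm_nonneg _).trans (hC 0 le_rfl)
  -- If `ν` and `⟨f, ϑ⟩` are below `η`, then `|⟨f s, ϑ t⟩| ≤ η (1 + C T)` on the window; square,
  -- integrate over length `T` and divide by `α`.
  set K := (1 + C * T) * √(T / α) with hK
  have hK0 : 0 ≤ K := by positivity
  have key : ∀ η > 0, ∀ᶠ t in atTop, ‖ϑ t‖ ≤ η * K := by
    intro η hη
    obtain ⟨N₁, hN₁⟩ := (Metric.tendsto_atTop.1 hν) η hη
    obtain ⟨N₂, hN₂⟩ := (Metric.tendsto_atTop.1 hg) η hη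
    filter_upwards [eventually_ge_atTop (max (max N₁ N₂) 0)] with t ht
    have ht0 : 0 ≤ t := (le_max_right _ _).trans ht
    have ht1 : N₁ ≤ t := ((le_max_left _ _).trans (le_max_left _ _)).trans ht
    have ht2 : N₂ ≤ t := ((le_max_right _ _).trans (le_max_left _ _)).trans ht
    have h1 : ‖∫ s in t..(t + T), inner ℝ (f s) (ϑ t) ^ 2‖
        ≤ (η * (1 + C * T)) ^ 2 * |t + T - t| := by
      refine intervalIntegral.norm_integral_le_of_norm_le_const fun s hs => ?_
      rw [Set.uIoc_of_le (by linarith)] at hs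
      have hs0 : 0 ≤ s := ht0.trans hs.1.le
      have h2 : |inner ℝ (f s) (ϑ s)| < η := by simpa using hN₂ s (ht2.trans hs.1.le)
      have h3 : ‖ϑ s - ϑ t‖ ≤ η * (s - t) := hϑ.norm_sub_le ht0 hs.1.le fun r hr _ => by
        simpa using (hN₁ r (ht1.trans hr)).le
      have h4 : |inner ℝ (f s) (ϑ s - ϑ t)| ≤ C * (η * T) :=
        (abs_real_inner_le_norm _ _).trans (mul_le_mul (hC s hs0)
          (h3.trans (mul_le_mul_of_nonneg_left (by linarith [hs.2]) hη.le)) (norm_nonneg _) hC0)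
      have h5 : |inner ℝ (f s) (ϑ t)| ≤ η * (1 + C * T) := by
        have : inner ℝ (f s) (ϑ t) = inner ℝ (f s) (ϑ s) - inner ℝ (f s) (ϑ s - ϑ t) := by
          rw [inner_sub_right]; ring
        rw [this]
        refine (abs_sub _ _).trans ?_
        linarith
      rw [norm_pow, Real.norm_eq_abs]
      exact pow_le_pow_left₀ (abs_nonneg _) h5 2
    rw [add_sub_cancel_left, abs_of_pos hT] at h1
    have h6 := (hPE t ht0 (ϑ t)).trans ((le_abs_self _).trans h1)
    have h7 : ‖ϑ t‖ ^ 2 ≤ (η * K) ^ 2 := by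
      have : (η * K) ^ 2 = (η * (1 + C * T)) ^ 2 * T / α := by
        rw [hK, mul_pow, mul_pow, Real.sq_sqrt (by positivity)]; ring
      rw [this, le_div_iff₀ hα]
      linarith
    exact le_of_sq_le_sq h7 (by positivity)
  rw [Metric.tendsto_atTop]
  intro ε hε
  obtain ⟨N, hN⟩ := eventually_atTop.1 (key (ε / (K + 1)) (by positivity))
  refine ⟨N, fun t ht => ?_⟩
  rw [dist_zero_right, norm_norm]
  refine (hN t ht).trans_lt ?_
  rw [div_mul_eq_mul_div, div_lt_iff₀ (by positivity)]
  nlinarith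

end AdaptiveSync

namespace AdaptiveSync

variable {n m : ℕ}

namespace Plant

/-! ### Analysis of the closed loop -/

/-- The part of the observer error that is explained neither by the noise nor by the parameter
error; it obeys the homogeneous error equation. -/
noncomputable def residualState (θ : EuclideanSpace ℝ (Fin m)) (x xh ζ Ξ : ℝ → Fin n → ℝ)
    (Ω : Fin m → ℝ → Fin n → ℝ) (t : ℝ) : Fin n → ℝ :=
  x t - xh t + ζ t - Ξ t - ∑ i, θ i • Ω i t

section ClosedLoop

variable {P : Plant n m} {k : Fin n → ℝ} {γ θs : ℝ} {θ : EuclideanSpace ℝ (Fin m)} {ξ : ℝ → ℝ}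
  {x xh ζ Ξ : ℝ → Fin n → ℝ} {θh : ℝ → EuclideanSpace ℝ (Fin m)} {Ω : Fin m → ℝ → Fin n → ℝ}

/-- Output injection turns `A (x - xh)` into `F (x - xh) - ξ k`. The input `φ̄ᵀθ̂` cancels between
observer and filter `ζ`; `Ω` removes `φ̄ᵀθ`, and `Ξ` removes everything due to evaluating at `y_r`
instead of `y`. -/
theorem IsClosedLoop.hasVelocity_residualState (h : P.IsClosedLoop k γ θs ξ x xh θh ζ Ω)
    (hx : P.IsTrajectory θ x) (hΞ : P.IsNoiseResponse k θ ξ x Ξ) :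
    HasVelocity (residualState θ x xh ζ Ξ Ω) fun t =>
      P.errorMatrix k *ᵥ residualState θ x xh ζ Ξ Ω t := by
  have hc := hasVelocity_combination h.regressor (HasVelocity.const θ)
  refine ((((HasVelocity.sub hx h.observer).add h.filter).sub hΞ).sub hc).congr
    (fun _ _ => rfl) fun t _ => ?_
  simp only [residualState, Matrix.mulVec_sub, Matrix.mulVec_add, inner_sub_left, PiLp.zero_apply,
    zero_smul, Finset.sum_const_zero]
  rw [P.errorMatrix_mulVec k (x t), P.errorMatrix_mulVec k (xh t)]
  simp only [received, output]
  module

/-- Pure algebra, valid for any signals; the dynamics enter only through the decay of the last term.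
-/
theorem augmentedError_eq (t : ℝ) :
    P.augmentedError ξ x xh θh ζ Ω t = inner ℝ (P.filteredRegressor Ω t) (θ - θh t)
      + ((ξ t + P.output Ξ t) + P.c ⬝ᵥ residualState θ x xh ζ Ξ Ω t) := by
  simp only [residualState, dotProduct_sub, dotProduct_add, P.output_combination, augmentedError,
    received, output, inner_sub_right]
  ring

theorem IsClosedLoop.hasVelocity_estimate (h : P.IsClosedLoop k γ θs ξ x xh θh ζ Ω)
    (θ : EuclideanSpace ℝ (Fin m)) (Ξ : ℝ → Fin n → ℝ) :
    HasVelocity θh fun t => (γ * (inner ℝ (P.filteredRegressor Ω t) (θ - θh t)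
      + ((ξ t + P.output Ξ t) + P.c ⬝ᵥ residualState θ x xh ζ Ξ Ω t))) • P.filteredRegressor Ω t
        - switching θs (θh t) • θh t :=
  h.adaptation.congr (fun _ _ => rfl) fun t _ => by rw [augmentedError_eq (θ := θ) (Ξ := Ξ)]

theorem boundedSignal_noiseResponse (hφ₀ : LocallyBounded P.φ₀) (hφ : LocallyBounded P.φ)
    (hF : IsHurwitz (P.errorMatrix k)) (hxb : BoundedSignal x) (hξ : BoundedSignal ξ)
    (hΞ : P.IsNoiseResponse k θ ξ x Ξ) : BoundedSignal Ξ :=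
  hF.boundedSignal hΞ.hasVelocity (boundedSignal_noiseForcing hφ₀ hφ k hxb hξ)

theorem IsClosedLoop.boundedSignal_regressor (h : P.IsClosedLoop k γ θs ξ x xh θh ζ Ω)
    (hφ : LocallyBounded P.φ) (hF : IsHurwitz (P.errorMatrix k)) (hxb : BoundedSignal x)
    (hξ : BoundedSignal ξ) (i : Fin m) : BoundedSignal (Ω i) :=
  hF.boundedSignal (h.regressor i)
    ((((boundedSignal_received hxb hξ).comp hφ).clm
      (EuclideanSpace.proj i : EuclideanSpace ℝ (Fin m) →L[ℝ] ℝ)).smul (BoundedSignal.const P.b))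

theorem IsClosedLoop.tendsto_residualState (h : P.IsClosedLoop k γ θs ξ x xh θh ζ Ω)
    (hF : IsHurwitz (P.errorMatrix k)) (hx : P.IsTrajectory θ x)
    (hΞ : P.IsNoiseResponse k θ ξ x Ξ) :
    BoundedSignal (residualState θ x xh ζ Ξ Ω) ∧
      Tendsto (residualState θ x xh ζ Ξ Ω) atTop (𝓝 0) := by
  have h1 : HasVelocity (residualState θ x xh ζ Ξ Ω) fun t =>
      P.errorMatrix k *ᵥ residualState θ x xh ζ Ξ Ω t + (fun _ => 0) t :=
    (h.hasVelocity_residualState hx hΞ).congr (fun _ _ => rfl) fun t _ => (add_zero _).symm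
  exact ⟨hF.boundedSignal h1 (BoundedSignal.const 0), hF.tendsto_zero h1 tendsto_const_nhds⟩

theorem IsClosedLoop.boundedSignal_parameter (h : P.IsClosedLoop k γ θs ξ x xh θh ζ Ω)
    (hφ₀ : LocallyBounded P.φ₀) (hφ : LocallyBounded P.φ)
    (hF : IsHurwitz (P.errorMatrix k)) (hγ : 0 < γ) (hθs : 0 < θs) (hx : P.IsTrajectory θ x)
    (hxb : BoundedSignal x) (hξ : BoundedSignal ξ) (hΞ : P.IsNoiseResponse k θ ξ x Ξ) :
    BoundedSignal θh := by
  have hΞb := boundedSignal_noiseResponse hφ₀ hφ hF hxb hξ hΞ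
  exact boundedSignal_estimate hγ hθs (h.hasVelocity_estimate θ Ξ)
    ((hξ.add (P.boundedSignal_output hΞb)).add
      (P.boundedSignal_output (h.tendsto_residualState hF hx hΞ).1))

/-- The order matters: `Ω` and `θh` are bounded before `ζ`, whose input contains `θh`; `xh` is then
read off from the residual state, since its own equation involves `A`, which need not be Hurwitz. -/
theorem IsClosedLoop.boundedSignals (h : P.IsClosedLoop k γ θs ξ x xh θh ζ Ω)
    (hφ₀ : LocallyBounded P.φ₀) (hφ : LocallyBounded P.φ)
    (hF : IsHurwitz (P.errorMatrix k)) (hγ : 0 < γ) (hθs : 0 < θs) (hx : P.IsTrajectory θ x)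
    (hxb : BoundedSignal x) (hξ : BoundedSignal ξ) (hΞ : P.IsNoiseResponse k θ ξ x Ξ) :
    BoundedSignal x ∧ BoundedSignal (P.output x) ∧ BoundedSignal (P.received ξ x) ∧
      BoundedSignal xh ∧ BoundedSignal (P.output xh) ∧
      BoundedSignal θh ∧ BoundedSignal (fun t => θ - θh t) ∧
      BoundedSignal ζ ∧ BoundedSignal (P.output ζ) ∧
      (∀ i, BoundedSignal (Ω i)) ∧ BoundedSignal (P.filteredRegressor Ω) ∧
      BoundedSignal (P.augmentedError ξ x xh θh ζ Ω) := by
  have hyr := P.boundedSignal_received hxb hξ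
  have hΞb := boundedSignal_noiseResponse hφ₀ hφ hF hxb hξ hΞ
  have hθb := h.boundedSignal_parameter hφ₀ hφ hF hγ hθs hx hxb hξ hΞ
  have hΩb := h.boundedSignal_regressor hφ hF hxb hξ
  have hωb := P.boundedSignal_filteredRegressor hΩb
  have hζb : BoundedSignal ζ := hF.boundedSignal h.filter
    (((hyr.comp hφ).inner hθb).smul (BoundedSignal.const P.b))
  have hcomb : BoundedSignal fun t => ∑ i, θ i • Ω i t := by
    obtain ⟨C, hC0, hC⟩ := exists_norm_combination_le hΩb
    exact ⟨C * ‖θ‖, fun t ht => hC t ht θ⟩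
  have hxhb : BoundedSignal xh := by
    have h1 := ((hxb.add hζb).sub hΞb).sub hcomb |>.sub (h.tendsto_residualState hF hx hΞ).1
    have h2 : (fun t => x t + ζ t - Ξ t - ∑ i, θ i • Ω i t - residualState θ x xh ζ Ξ Ω t)
        = xh := by
      ext1 t
      unfold residualState
      abel
    rwa [h2] at h1
  exact ⟨hxb, P.boundedSignal_output hxb, hyr, hxhb, P.boundedSignal_output hxhb, hθb,
    (BoundedSignal.const θ).sub hθb, hζb, P.boundedSignal_output hζb, hΩb, hωb,
    ((hyr.sub (P.boundedSignal_output hxhb)).add (P.boundedSignal_output hζb)).sub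
      (hωb.inner hθb)⟩

theorem IsClosedLoop.tendsto_residualSet (h : P.IsClosedLoop k γ θs ξ x xh θh ζ Ω)
    (hφ₀ : LocallyBounded P.φ₀) (hφ : LocallyBounded P.φ)
    (hF : IsHurwitz (P.errorMatrix k)) (hγ : 0 < γ) (hθs : 0 < θs) (hx : P.IsTrajectory θ x)
    (hxb : BoundedSignal x) (hξ : BoundedSignal ξ) (hΞ : P.IsNoiseResponse k θ ξ x Ξ) :
    Tendsto (fun t => Metric.infDist (θ - θh t)
      (residualSet γ θs θ fun s => ξ s + P.output Ξ s)) atTop (𝓝 0) := by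
  have hΞb := boundedSignal_noiseResponse hφ₀ hφ hF hxb hξ hΞ
  refine tendsto_infDist_residualSet hγ hθs (h.hasVelocity_estimate θ Ξ)
    (hξ.add (P.boundedSignal_output hΞb)) ?_
  have := ((dotCLM P.c).continuous.tendsto 0).comp (h.tendsto_residualState hF hx hΞ).2
  rwa [map_zero] at this

/-- Without noise the zero response is admissible, so the only disturbance left in the regression is
the exponentially decaying residual. -/
theorem isNoiseResponse_zero (hξ0 : ∀ t, 0 ≤ t → ξ t = 0) :
    P.IsNoiseResponse k θ ξ x fun _ => 0 := by
  refine (HasVelocity.const (0 : Fin n → ℝ)).congr (fun _ _ => rfl) fun t ht => ?_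
  have h1 : P.received ξ x t = P.output x t := by rw [received, hξ0 t ht, add_zero]
  simp [h1, hξ0 t ht]

/-- In the noise-free case the regression error and the velocity of the estimate tend to zero. -/
theorem IsClosedLoop.tendsto_zero_of_noiseless (h : P.IsClosedLoop k γ θs ξ x xh θh ζ Ω)
    (hφ : LocallyBounded P.φ)
    (hF : IsHurwitz (P.errorMatrix k)) (hγ : 0 < γ) (hθs : 0 < θs) (hx : P.IsTrajectory θ x)
    (hxb : BoundedSignal x) (hξ : BoundedSignal ξ) (hξ0 : ∀ t, 0 ≤ t → ξ t = 0)
    (hθ : ‖θ‖ < θs) :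
    Tendsto (fun t => inner ℝ (P.filteredRegressor Ω t) (θ - θh t)) atTop (𝓝 0) ∧
      Tendsto (P.augmentedError ξ x xh θh ζ Ω) atTop (𝓝 0) ∧
      Tendsto (fun t => (γ * P.augmentedError ξ x xh θh ζ Ω t) • P.filteredRegressor Ω t
        - switching θs (θh t) • θh t) atTop (𝓝 0) := by
  set Ξ : ℝ → Fin n → ℝ := fun _ => 0 with hΞdef
  have hΞ : P.IsNoiseResponse k θ ξ x Ξ := isNoiseResponse_zero hξ0
  have hΩb := h.boundedSignal_regressor hφ hF hxb hξ
  have hωb := P.boundedSignal_filteredRegressor hΩb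
  have hfb := (P.boundedSignal_received hxb hξ).comp hφ
  have hnoise (t : ℝ) (ht : 0 ≤ t) : ξ t + P.output Ξ t = 0 := by
    rw [hξ0 t ht]; simp [hΞdef, output]
  obtain ⟨a, C, ha, hC⟩ := hF.exists_exp_decay (h.hasVelocity_residualState hx hΞ) P.c
  let toE := (EuclideanSpace.equiv (Fin m) ℝ).symm.toContinuousLinearMap
  let Ω' (i : Fin m) (t : ℝ) : Fin n → ℝ :=
    P.errorMatrix k *ᵥ Ω i t + P.φ (P.received ξ x t) i • P.b
  -- The velocity of `ω̄` is the output of the bounded velocities of the filter states.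
  have hω : HasVelocity (P.filteredRegressor Ω) (P.filteredRegressor Ω') :=
    (HasVelocity.pi fun i => HasVelocity.clm (h.regressor i) (dotCLM P.c)).clm toE
  have hΩb' (i : Fin m) : BoundedSignal (Ω' i) :=
    ((hΩb i).clm (mulVecCLM (P.errorMatrix k))).add ((hfb.clm
      (EuclideanSpace.proj i : EuclideanSpace ℝ (Fin m) →L[ℝ] ℝ)).smul (BoundedSignal.const P.b))
  obtain ⟨hq, hsw⟩ := tendsto_zero_of_exp_decay hγ hθs hθ (h.hasVelocity_estimate θ Ξ) hω hωb
    (P.boundedSignal_filteredRegressor hΩb') ha fun t ht => by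
      rw [hnoise t ht, zero_add]
      exact hC t ht
  have he : Tendsto (P.augmentedError ξ x xh θh ζ Ω) atTop (𝓝 0) := by
    have h1 := ((dotCLM P.c).continuous.tendsto 0).comp (h.tendsto_residualState hF hx hΞ).2
    rw [map_zero] at h1
    have h2 := hq.add h1
    rw [add_zero] at h2
    refine h2.congr' ?_
    filter_upwards [eventually_ge_atTop 0] with t ht
    rw [augmentedError_eq (θ := θ) (Ξ := Ξ), hnoise t ht, zero_add]
    rfl
  refine ⟨hq, he, ?_⟩
  obtain ⟨D, hD⟩ := hωb
  have h3 : Tendsto (fun t => (γ * P.augmentedError ξ x xh θh ζ Ω t) • P.filteredRegressor Ω t)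
      atTop (𝓝 0) := by
    have h4 : Tendsto (fun t => ‖γ * P.augmentedError ξ x xh θh ζ Ω t‖ * D) atTop (𝓝 0) := by
      simpa using ((he.const_mul γ).norm).mul_const D
    refine squeeze_zero_norm' ?_ h4
    filter_upwards [eventually_ge_atTop 0] with t ht
    rw [norm_smul]
    exact mul_le_mul_of_nonneg_left (hD t ht) (norm_nonneg _)
  simpa using h3.sub hsw

theorem tendsto_combination (hΩ : ∀ i, BoundedSignal (Ω i)) {ν : ℝ → EuclideanSpace ℝ (Fin m)}
    (hν : Tendsto ν atTop (𝓝 0)) : Tendsto (fun t => ∑ i, ν t i • Ω i t) atTop (𝓝 0) := by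
  obtain ⟨C, hC0, hC⟩ := exists_norm_combination_le hΩ
  have h1 : Tendsto (fun t => C * ‖ν t‖) atTop (𝓝 0) := by
    simpa using (hν.norm).const_mul C
  refine squeeze_zero_norm' ?_ h1
  filter_upwards [eventually_ge_atTop 0] with t ht using hC t ht (ν t)

/-- Regulation of the output error in the noise-free case. -/
theorem IsClosedLoop.tendsto_output_error (h : P.IsClosedLoop k γ θs ξ x xh θh ζ Ω)
    (hφ : LocallyBounded P.φ)
    (hF : IsHurwitz (P.errorMatrix k)) (hγ : 0 < γ) (hθs : 0 < θs) (hx : P.IsTrajectory θ x)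
    (hxb : BoundedSignal x) (hξ : BoundedSignal ξ) (hξ0 : ∀ t, 0 ≤ t → ξ t = 0)
    (hθ : ‖θ‖ < θs) :
    Tendsto (fun t => P.output x t - P.output xh t) atTop (𝓝 0) := by
  obtain ⟨-, he, hν⟩ := h.tendsto_zero_of_noiseless hφ hF hγ hθs hx hxb hξ hξ0 hθ
  have hΩb := h.boundedSignal_regressor hφ hF hxb hξ
  -- Swapping: both terms carry the input `φ̄ᵀθ̂`, so their difference is driven only by the
  -- vanishing velocity of the estimate.
  have hswap := HasVelocity.sub h.filter (hasVelocity_combination h.regressor h.adaptation)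
  have hlim : Tendsto (fun t => ζ t - ∑ i, θh t i • Ω i t) atTop (𝓝 0) := by
    refine hF.tendsto_zero (hswap.congr (fun _ _ => rfl) fun t _ => ?_)
      (by simpa using (tendsto_combination hΩb hν).neg)
    rw [Matrix.mulVec_sub]
    abel
  have h1 := ((dotCLM P.c).continuous.tendsto 0).comp hlim
  rw [map_zero] at h1
  have h2 := he.sub h1
  rw [sub_zero] at h2
  refine h2.congr' ?_
  filter_upwards [eventually_ge_atTop 0] with t ht
  simp only [Function.comp, dotCLM_apply, dotProduct_sub, P.output_combination, augmentedError,
    received, output, hξ0 t ht]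
  ring

/-- Parameter convergence in the noise-free case, under persistent excitation. -/
theorem IsClosedLoop.tendsto_parameter_error (h : P.IsClosedLoop k γ θs ξ x xh θh ζ Ω)
    (hφ₀ : LocallyBounded P.φ₀) (hφ : LocallyBounded P.φ)
    (hF : IsHurwitz (P.errorMatrix k)) (hγ : 0 < γ) (hθs : 0 < θs) (hx : P.IsTrajectory θ x)
    (hxb : BoundedSignal x) (hξ : BoundedSignal ξ) (hξ0 : ∀ t, 0 ≤ t → ξ t = 0)
    (hθ : ‖θ‖ < θs) (hφc : Continuous P.φ)
    (hPE : PersistentlyExciting fun t => P.φ (P.output x t))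
    (hmp : IsMinimumPhase (P.errorMatrix k) P.b P.c) :
    Tendsto (fun t => ‖θ - θh t‖) atTop (𝓝 0) := by
  obtain ⟨hq, -, hν⟩ := h.tendsto_zero_of_noiseless hφ hF hγ hθs hx hxb hξ hξ0 hθ
  obtain ⟨-, hyb, hyrb, -, -, hθb, hθtb, -, -, hΩb, hωb, heb⟩ :=
    h.boundedSignals hφ₀ hφ hF hγ hθs hx hxb hξ (isNoiseResponse_zero hξ0)
  set ν : ℝ → EuclideanSpace ℝ (Fin m) := fun t =>
    (γ * P.augmentedError ξ x xh θh ζ Ω t) • P.filteredRegressor Ω t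
      - switching θs (θh t) • θh t with hνdef
  have hθh : HasVelocity θh ν := h.adaptation
  have hswb : BoundedSignal fun t => switching θs (θh t) • θh t := by
    obtain ⟨B, hB⟩ := hθb
    refine ⟨B, fun t ht => ?_⟩
    rw [norm_smul, Real.norm_of_nonneg (switching_nonneg hθs _)]
    exact (mul_le_of_le_one_left (norm_nonneg _) (switching_le_one hθs _)).trans (hB t ht)
  have hνb : BoundedSignal ν := (((BoundedSignal.const γ).smul heb).smul hωb).sub hswb
  have hν' : Tendsto (fun t => 0 - ν t) atTop (𝓝 0) := by simpa using hν.neg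
  have hνb' : BoundedSignal fun t => 0 - ν t := (BoundedSignal.const 0).sub hνb
  have hθt : HasVelocity (fun t => θ - θh t) fun t => 0 - ν t := (HasVelocity.const θ).sub hθh
  have hyuc : UniformContinuousOn (P.output x) (Set.Ici 0) := by
    refine (HasVelocity.clm hx (dotCLM P.c)).uniformContinuousOn ?_
    exact (((hxb.clm (mulVecCLM P.A)).add (hyb.comp hφ₀)).add
      (((hyb.comp hφ).inner (BoundedSignal.const θ)).smul (BoundedSignal.const P.b))).clm
        (dotCLM P.c)
  -- The output is Lipschitz with values in a compact interval, on which the continuous `φ` is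
  -- uniformly continuous; the inversion of the filter needs this of its input.
  have hfuc : UniformContinuousOn (fun t => P.φ (P.output x t)) (Set.Ici 0) := by
    obtain ⟨R, hR⟩ := hyb
    have h1 : UniformContinuousOn P.φ (Set.Icc (-R) R) :=
      isCompact_Icc.uniformContinuousOn_of_continuous hφc.continuousOn
    exact h1.comp hyuc fun t ht => abs_le.1 (hR t ht)
  have hguc := uniformContinuousOn_inner hfuc (hθt.uniformContinuousOn hνb') (hyb.comp hφ) hθtb
  have hfy (t : ℝ) (ht : 0 ≤ t) : P.received ξ x t = P.output x t := by
    rw [received, hξ0 t ht, add_zero]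
  -- This filter state has input `φᵀθ̃`, a vanishing perturbation, and output the regression error.
  have hcomb := hasVelocity_combination h.regressor hθt
  obtain ⟨C, hC0, hC⟩ := exists_norm_combination_le hΩb
  have hcb {w : ℝ → EuclideanSpace ℝ (Fin m)} (hw : BoundedSignal w) :
      BoundedSignal fun t => ∑ i, w t i • Ω i t := by
    obtain ⟨D, hD⟩ := hw
    exact ⟨C * D, fun t ht => (hC t ht _).trans (mul_le_mul_of_nonneg_left (hD t ht) hC0)⟩
  have hZuc := hcomb.uniformContinuousOn (((hcb hθtb).clm (mulVecCLM (P.errorMatrix k))).add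
    ((((hyrb.comp hφ).inner hθtb).smul (BoundedSignal.const P.b)).add (hcb hνb')))
  have hg : Tendsto (fun t => inner ℝ (P.φ (P.output x t)) (θ - θh t)) atTop (𝓝 0) := by
    refine hmp.input_tendsto_zero hF (hcomb.congr (fun _ _ => rfl) fun t ht => ?_) hZuc hguc
      (tendsto_combination hΩb hν') ?_
    · rw [hfy t ht]
    · simpa only [P.output_combination] using hq
  exact hPE.tendsto_zero hθt hν' hg

end ClosedLoop

end Plant

end AdaptiveSync

/-! ### Assembly of the theorem -/

theorem theorem4 {n m : ℕ} (P : Plant n m)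
    (hφ₀_meas : Measurable P.φ₀) (hφ_meas : Measurable P.φ)
    (hφ₀ : LocallyBounded P.φ₀) (hφ : LocallyBounded P.φ)
    (hP : P.BoundedTrajectories)
    (k : Fin n → ℝ) (hF : IsHurwitz (P.errorMatrix k))
    (θ : EuclideanSpace ℝ (Fin m))
    (ξ : ℝ → ℝ) (hξ_meas : AEMeasurable ξ (volume.restrict (Set.Ici (0 : ℝ))))
    (hξ : BoundedSignal ξ)
    (γ θs : ℝ) (hγ : 0 < γ) (hθs : 0 < θs)
    (x : ℝ → Fin n → ℝ) (hx : P.IsTrajectory θ x) :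
    -- the closed loop has a solution on `[0, ∞)` for all initial conditions
    (∀ (xh₀ : Fin n → ℝ) (θh₀ : EuclideanSpace ℝ (Fin m)) (ζ₀ : Fin n → ℝ)
        (Ω₀ : Fin m → Fin n → ℝ),
      ∃ (xh : ℝ → Fin n → ℝ) (θh : ℝ → EuclideanSpace ℝ (Fin m)) (ζ : ℝ → Fin n → ℝ)
        (Ω : Fin m → ℝ → Fin n → ℝ),
        P.IsClosedLoop k γ θs ξ x xh θh ζ Ω ∧
          xh 0 = xh₀ ∧ θh 0 = θh₀ ∧ ζ 0 = ζ₀ ∧ ∀ i, Ω i 0 = Ω₀ i) ∧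
    (∀ Ξ₀ : Fin n → ℝ, ∃ Ξ : ℝ → Fin n → ℝ, P.IsNoiseResponse k θ ξ x Ξ ∧ Ξ 0 = Ξ₀) ∧
    -- and every solution has the following properties
    ∀ (xh : ℝ → Fin n → ℝ) (θh : ℝ → EuclideanSpace ℝ (Fin m)) (ζ : ℝ → Fin n → ℝ)
      (Ω : Fin m → ℝ → Fin n → ℝ),
      P.IsClosedLoop k γ θs ξ x xh θh ζ Ω →
        -- (i) boundedness of all signals
        (BoundedSignal x ∧ BoundedSignal (P.output x) ∧ BoundedSignal (P.received ξ x) ∧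
          BoundedSignal xh ∧ BoundedSignal (P.output xh) ∧
          BoundedSignal θh ∧ BoundedSignal (fun t => θ - θh t) ∧
          BoundedSignal ζ ∧ BoundedSignal (P.output ζ) ∧
          (∀ i, BoundedSignal (Ω i)) ∧ BoundedSignal (P.filteredRegressor Ω) ∧
          BoundedSignal (P.augmentedError ξ x xh θh ζ Ω)) ∧
        -- (i) convergence of the parameter error to the residual set
        (∀ Ξ : ℝ → Fin n → ℝ, P.IsNoiseResponse k θ ξ x Ξ →
          BoundedSignal Ξ ∧ BoundedSignal (P.output Ξ) ∧
          Tendsto (fun t => Metric.infDist (θ - θh t)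
              (residualSet γ θs θ fun s => ξ s + P.output Ξ s))
            atTop (𝓝 0)) ∧
        ((∀ t, 0 ≤ t → ξ t = 0) → ‖θ‖ < θs →
          -- (ii) regulation of the output error
          Tendsto (fun t => P.output x t - P.output xh t) atTop (𝓝 0) ∧
          -- (iii) parameter convergence
          (Continuous P.φ → PersistentlyExciting (fun t => P.φ (P.output x t)) →
            IsMinimumPhase (P.errorMatrix k) P.b P.c →
            Tendsto (fun t => ‖θ - θh t‖) atTop (𝓝 0))) := by
  have hxb : BoundedSignal x := hP θ x hx
  refine ⟨fun xh₀ θh₀ ζ₀ Ω₀ => Plant.exists_isClosedLoop hφ₀_meas hφ_meas hφ₀ hφ hF hξ_meas hξ hγ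
    hθs hx hxb xh₀ θh₀ ζ₀ Ω₀,
    fun Ξ₀ => Plant.exists_isNoiseResponse hφ₀_meas hφ_meas hφ₀ hφ k hξ_meas hξ hx hxb Ξ₀,
    fun xh θh ζ Ω h => ⟨?_, fun Ξ hΞ => ?_, fun hξ0 hθ => ⟨?_, fun hφc hPE hmp => ?_⟩⟩⟩
  -- The bounds do not mention `Ξ`; any single response, here the one from `0`, serves as an
  -- auxiliary signal.
  · obtain ⟨Ξ, hΞ, -⟩ :=
      Plant.exists_isNoiseResponse hφ₀_meas hφ_meas hφ₀ hφ k hξ_meas hξ hx hxb 0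
    exact h.boundedSignals hφ₀ hφ hF hγ hθs hx hxb hξ hΞ
  · have hΞb := Plant.boundedSignal_noiseResponse hφ₀ hφ hF hxb hξ hΞ
    exact ⟨hΞb, P.boundedSignal_output hΞb, h.tendsto_residualSet hφ₀ hφ hF hγ hθs hx hxb hξ hΞ⟩
  · exact h.tendsto_output_error hφ hF hγ hθs hx hxb hξ hξ0 hθ
  · exact h.tendsto_parameter_error hφ₀ hφ hF hγ hθs hx hxb hξ hξ0 hθ hφc hPE hmp
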